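/- Let $d\ge 1$ and let $\Phi$ be a Poisson point process in $\mathbb{R}^d$ whose intensity measure is the Lebesgue measure. Let $$\mathcal{C}_0=\{y\in\mathbb{R}^d : \|y\|\le\|x-y\|\ \text{ for all } x\in\Phi\}$$ be the cell of the nucleus $0$ in the Voronoi tessellation generated by $\Phi\cup\{0\}$ (the typical cell). A vertex $c$ of the convex polyhedron $\mathcal{C}_0$ is called pointy if the distance to the nucleus, $y\mapsto\|y\|$ on $\mathcal{C}_0$, has a local maximum at $c$. For $t>0$ let $\mathcal{V}_{\blacktriangle}^{\ge t}$ be the set of pointy vertices $c$ of $\mathcal{C}_0$ with $\|c\|\ge t$, and let $\#(\mathcal{V}_{\blacktriangle}^{\ge t})$ be its cardinality. Put $$\kappa_d=\frac{\pi^{d/2}}{\Gamma(\frac d2+1)},\qquad C_d=\mathbb{E}\left[\Delta_d(U_0,\dots,U_d)\,1_{0\in\mathrm{Conv}(P_{U_0^\perp}(U_1),\dots,P_{U_0^\perp}(U_d))}\right],$$ where $U_0,\dots,U_d$ are i.i.d. uniform random points of the unit sphere of $\mathbb{R}^d$, $\Delta_d(U_0,\dots,U_d)$ is the $d$-dimensional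 volume of the simplex with vertices $U_0,\dots,U_d$, $P_{u^\perp}$ is the orthogonal projection onto the hyperplane orthogonal to $u$, and $\mathrm{Conv}$ denotes the relative interior of the convex hull of the points. Then $\#(\mathcal{V}_{\blacktriangle}^{\ge t})$ is almost everywhere equal to a measurable random variable, and for every $t>0$ $$\mathbb{E}\left[\#(\mathcal{V}_{\blacktriangle}^{\ge t})\right]=(d\kappa_d)^d\,C_d\sum_{i=0}^{d-1}t^{di}\,\kappa_d^{\,i-d+1}\,\frac{(d-1)!}{i!}\,e^{-\kappa_d t^d}.$$ Consequently, as $t\to\infty$, $$\mathbb{E}\left[\#(\mathcal{V}_{\blacktriangle}^{\ge t})\right]\sim(d\kappa_d)^d\,C_d\,t^{d(d-1)}\,e^{-\kappa_d t^d}.$$ -/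

import Mathlib

open MeasureTheory ProbabilityTheory Filter Asymptotics
open scoped ENNReal Nat RealInnerProductSpace

namespace PoissonVoronoi

/-- The Euclidean space `ℝ^d`. -/
abbrev Space (d : ℕ) : Type := EuclideanSpace ℝ (Fin d)

/-- The unit sphere of `ℝ^d`. -/
abbrev Sphere (d : ℕ) : Type := Metric.sphere (0 : Space d) 1

/-- `Φ` is a Poisson point process on `E` with (diffuse, σ-finite) intensity measure `μ`, seen as a
random set of points: the number of points in a measurable set is a random variable, it is
Poisson distributed with parameter `μ B` when `μ B` is finite, and the numbers of points in
finitely many pairwise disjoint measurable sets are independent. -/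
structure IsPoissonPointProcess {Ω E : Type*} [MeasurableSpace Ω] [MeasurableSpace E]
    (Φ : Ω → Set E) (μ : Measure E) (P : Measure Ω) : Prop where
  measurable_count : ∀ B : Set E, MeasurableSet B →
    Measurable (fun ω => (Φ ω ∩ B).encard)
  law_count : ∀ B : Set E, MeasurableSet B → μ B < ∞ →
    P.map (fun ω => (Φ ω ∩ B).encard) =
      (poissonMeasure (μ B).toNNReal).map (fun n : ℕ => (n : ℕ∞))
  indep_count : ∀ (n : ℕ) (B : Fin n → Set E), (∀ i, MeasurableSet (B i)) →
    Pairwise (fun i j => Disjoint (B i) (B j)) →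
    iIndepFun (fun i ω => (Φ ω ∩ B i).encard) P

/-- The Voronoi cell of the nucleus `x` with respect to the point set `S`. -/
def voronoiCell {d : ℕ} (x : Space d) (S : Set (Space d)) : Set (Space d) :=
  {y | ∀ x' ∈ S, ‖x - y‖ ≤ ‖x' - y‖}

/-- The cell of the origin in the Voronoi tessellation generated by `S ∪ {0}`; it is the typical
cell when `S` is a homogeneous Poisson point process. -/
def zeroNucleusCell {d : ℕ} (S : Set (Space d)) : Set (Space d) :=
  voronoiCell 0 (S ∪ {0})

/-- The pointy vertices of the cell of the origin: the vertices (that is, the extreme points) of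
this convex polyhedron at which the distance to the nucleus `0`, restricted to the cell, has a local
maximum. -/
def pointyVertices {d : ℕ} (S : Set (Space d)) : Set (Space d) :=
  {c | c ∈ (zeroNucleusCell S).extremePoints ℝ ∧
    IsLocalMaxOn (fun y : Space d => ‖y‖) (zeroNucleusCell S) c}

/-- The pointy vertices at distance at least `t` from the nucleus `0`. -/
def farPointyVertices {d : ℕ} (S : Set (Space d)) (t : ℝ) : Set (Space d) :=
  {c | c ∈ pointyVertices S ∧ t ≤ ‖c‖}

/-- The (possibly infinite) number of pointy vertices at distance at least `t` from `0`. -/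
noncomputable def numFarPointy {d : ℕ} (S : Set (Space d)) (t : ℝ) : ℝ≥0∞ :=
  ((farPointyVertices S t).encard : ℝ≥0∞)

/-- The volume `κ_d` of the unit ball of `ℝ^d`. -/
noncomputable def kappa (d : ℕ) : ℝ :=
  Real.pi ^ ((d : ℝ) / 2) / Real.Gamma ((d : ℝ) / 2 + 1)

/-- The uniform distribution on the unit sphere of `ℝ^d`: the normalized surface measure. -/
noncomputable def uniformSphere (d : ℕ) : Measure (Sphere d) :=
  ((volume : Measure (Space d)).toSphere Set.univ)⁻¹ • (volume : Measure (Space d)).toSphere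

/-- The `d`-dimensional volume of the simplex with vertices `u 0, …, u d`. -/
noncomputable def simplexVolume {d : ℕ} (u : Fin (d + 1) → Sphere d) : ℝ :=
  (volume (convexHull ℝ (Set.range fun i => (u i : Space d)))).toReal

/-- The origin lies in the relative interior of the convex hull of the orthogonal projections of
`u 1, …, u d` onto the hyperplane orthogonal to `u 0`. -/
def pointyCondition {d : ℕ} (u : Fin (d + 1) → Sphere d) : Prop :=
  (0 : Space d) ∈ intrinsicInterior ℝ (convexHull ℝ (Set.range fun i : Fin d =>
    (ℝ ∙ (u 0 : Space d))ᗮ.starProjection (u i.succ : Space d)))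

/-- `C_d`: the expectation of the volume of the simplex spanned by `d + 1` i.i.d. uniform points of
the unit sphere, times the indicator function of the pointy condition. -/
noncomputable def simplexConst (d : ℕ) : ℝ :=
  ∫ u, {u : Fin (d + 1) → Sphere d | pointyCondition u}.indicator simplexVolume u
    ∂(Measure.pi fun _ : Fin (d + 1) => uniformSphere d)

end PoissonVoronoi

/-! The cell of the origin is the intersection of the half-spaces `⟪s, y⟫ ≤ ‖s‖ ^ 2 / 2`, and `c`
belongs to it exactly when the open ball `ball c ‖c‖` contains no point of the process. At a vertex
the tight nuclei span the space, and almost surely there are exactly `d` of them, since by the Mecke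
formula the expected number of `(d + 1)`-tuples cospherical with the origin is zero. First-order
optimality then identifies the pointy vertices: `‖·‖` has a local maximum at `c` if and only if `c`
is a combination of the tight nuclei with strictly positive coefficients. So `d!` times the number
of far pointy vertices counts the ordered `d`-tuples of the process that satisfy a deterministic
cone condition and have a void circumscribed ball (`encard_voidPointyTuples`).

The Mecke formula `mecke_void` turns the expected count into an integral over `d`-tuples `x` of `exp
(-κ_d ‖c‖ ^ d)`, where `c` is the circumcenter. The Blaschke–Petkantschin formula for spheres
through the origin (`lintegral_blaschke_petkantschin`) replaces `x` by the center `c` and `d`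
directions `u i`, with `x i = c + ‖c‖ • u i`. It comes from polar coordinates, a linear change from
radii to center, and the inscribed angle theorem: seen from the center, the angle with the axis is
twice the one seen from the origin (`map_doublingSphere`).

Writing `c = -r • v`, the point `v` joins the `u i` as a further point of the sphere, the Jacobian
determinant becomes `d!` times a simplex volume (`simplexVolume_eq`), and the cone condition becomes
the projection condition in the definition of `C_d` (`pointyCondition_iff`). The integral thus
splits into `C_d`, up to constants, and a radial integral, which is an incomplete gamma integral at
an integer parameter (`lintegral_radial_tail`) and hence a finite sum. Its top-degree term gives the
asymptotics. -/

namespace PoissonVoronoi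

/-! ### Void indicators -/

section Void

variable {E : Type*}

/-- The indicator that `S` has no point in `K`. -/
noncomputable def void (S K : Set E) : ℝ≥0∞ :=
  open Classical in if S ∩ K = ∅ then 1 else 0

lemma void_eq_count (S K : Set E) :
    void S K = if (S ∩ K).encard = 0 then 1 else 0 := by
  simp only [void, Set.encard_eq_zero]

lemma void_le_one (S K : Set E) : void S K ≤ 1 := by
  unfold void
  split_ifs <;> simp

end Void

/-! ### Counting measures of tuples and the Mecke formula for a fixed void set -/

section Mecke

variable {Ω E : Type*} [MeasurableSpace Ω] [MeasurableSpace E]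

/-- The injective `k`-tuples of points of `S`. -/
def injTuples (S : Set E) (k : ℕ) : Set (Fin k → E) :=
  {x | Function.Injective x ∧ ∀ i, x i ∈ S}

/-- The counting measure of the injective `k`-tuples of points of `S`. -/
noncomputable def tupleMeasure (S : Set E) (k : ℕ) : Measure (Fin k → E) :=
  Measure.sum fun x : injTuples S k => Measure.dirac x.1

lemma tupleMeasure_apply {S : Set E} {k : ℕ} {A : Set (Fin k → E)} (hA : MeasurableSet A) :
    tupleMeasure S k A = ((injTuples S k ∩ A).encard : ℝ≥0∞) := by
  rw [tupleMeasure, Measure.sum_apply _ hA, ← ENNReal.tsum_set_one,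
    tsum_subtype (injTuples S k ∩ A) (fun _ => (1 : ℝ≥0∞)),
    ← Set.indicator_indicator, ← tsum_subtype]
  congr 1
  ext x
  rw [Measure.dirac_apply' _ hA]
  rfl

/-- Disjointness of the sides makes every tuple in the box injective, so the count factorizes. -/
lemma tupleMeasure_box {S : Set E} {k : ℕ} {B : Fin k → Set E}
    (hB : ∀ i, MeasurableSet (B i)) (hd : Pairwise fun i j => Disjoint (B i) (B j))
    (hf : ∀ i, (S ∩ B i).Finite) :
    tupleMeasure S k (Set.univ.pi B) = ∏ i, ((S ∩ B i).encard : ℝ≥0∞) := by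
  rw [tupleMeasure_apply (.univ_pi hB)]
  have h : injTuples S k ∩ Set.univ.pi B = Set.univ.pi fun i => S ∩ B i := by
    ext x
    simp only [injTuples, Set.mem_inter_iff, Set.mem_ofPred_eq, Set.mem_pi, Set.mem_univ,
      true_implies]
    constructor
    · rintro ⟨⟨-, h1⟩, h2⟩ i
      exact ⟨h1 i, h2 i⟩
    · intro h
      refine ⟨⟨fun i j hij => ?_, fun i => (h i).1⟩, fun i => (h i).2⟩
      by_contra hne
      exact Set.disjoint_left.1 (hd hne) (h i).2 (hij ▸ (h j).2)
  have hc : ∀ {α : Type _} (s : Set α), s.Finite →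
      ((s.encard : ℕ∞) : ℝ≥0∞) = ((Nat.card s : ℕ) : ℝ≥0∞) := by
    intro α s hs
    rw [← hs.cast_ncard_eq, Nat.card_coe_set_eq]
    rfl
  rw [h, hc _ (Set.Finite.pi hf), Finset.prod_congr rfl fun i _ => hc _ (hf i),
    ← Nat.cast_prod, ← Nat.card_pi]
  congr 1
  exact Nat.card_congr (Equiv.Set.univPi fun i => S ∩ B i)

lemma measurable_natCast_enat : Measurable fun n : ℕ∞ => (n : ℝ≥0∞) := Measurable.of_discrete

variable {Φ : Ω → Set E} {μ : Measure E} {P : Measure Ω}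

namespace IsPoissonPointProcess

lemma lintegral_count (hΦ : IsPoissonPointProcess Φ μ P) {B : Set E} (hB : MeasurableSet B)
    (hμ : μ B < ∞) : ∫⁻ ω, ((Φ ω ∩ B).encard : ℝ≥0∞) ∂P = μ B := by
  have h := hΦ.law_count B hB hμ
  rw [← lintegral_map (f := fun n : ℕ∞ => (n : ℝ≥0∞)) .of_discrete
    (hΦ.measurable_count B hB), h, lintegral_map .of_discrete .of_discrete, poissonMeasure,
    lintegral_sum_measure]
  simp only [lintegral_smul_measure, lintegral_dirac]
  set r := (μ B).toNNReal with hr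
  -- The term `n = 0` vanishes; after the shift, `(n + 1) / (n + 1)! = 1 / n !` leaves `r` times the
  -- total mass.
  rw [tsum_eq_zero_add' ENNReal.summable]
  have h1 : ∀ n : ℕ, ENNReal.ofReal (Real.exp (-(r : ℝ)) * (r : ℝ) ^ (n + 1) / ((n + 1)! : ℝ)) •
      (((n + 1 : ℕ) : ℕ∞) : ℝ≥0∞) =
        ENNReal.ofReal (r : ℝ) * ENNReal.ofReal (Real.exp (-(r : ℝ)) * (r : ℝ) ^ n / (n ! : ℝ)) := by
    intro n
    have : (((n + 1 : ℕ) : ℕ∞) : ℝ≥0∞) = ENNReal.ofReal ((n + 1 : ℕ) : ℝ) := by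
      rw [ENNReal.ofReal_natCast]; rfl
    rw [this, smul_eq_mul, ← ENNReal.ofReal_mul (by positivity),
      ← ENNReal.ofReal_mul (by positivity)]
    congr 1
    rw [Nat.factorial_succ]
    push_cast
    field_simp
    ring
  rw [tsum_congr h1, ENNReal.tsum_mul_left,
    ← ENNReal.ofReal_tsum_of_nonneg (fun n => by positivity) (hasSum_one_poissonMeasure r).summable,
    (hasSum_one_poissonMeasure r).tsum_eq]
  simp [hr, hμ.ne]

lemma ae_finite_count (hΦ : IsPoissonPointProcess Φ μ P) {B : Set E} (hB : MeasurableSet B)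
    (hμ : μ B < ∞) : ∀ᵐ ω ∂P, (Φ ω ∩ B).Finite := by
  have h := ae_lt_top (measurable_natCast_enat.comp (hΦ.measurable_count B hB))
    (((hΦ.lintegral_count hB hμ).trans_lt hμ).ne)
  filter_upwards [h] with ω hω
  rw [← Set.encard_lt_top_iff]
  by_contra hc
  simp only [not_lt, top_le_iff] at hc
  simp [hc] at hω

lemma measurable_void (hΦ : IsPoissonPointProcess Φ μ P) {K : Set E} (hK : MeasurableSet K) :
    Measurable fun ω => void (Φ ω) K := by
  simp only [void_eq_count]
  exact (Measurable.of_discrete (f := fun n : ℕ∞ => if n = 0 then (1 : ℝ≥0∞) else 0)).comp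
    (hΦ.measurable_count K hK)

lemma lintegral_void (hΦ : IsPoissonPointProcess Φ μ P) {K : Set E} (hK : MeasurableSet K)
    (hμ : μ K < ∞) :
    ∫⁻ ω, void (Φ ω) K ∂P = ENNReal.ofReal (Real.exp (-(μ K).toReal)) := by
  have h := hΦ.law_count K hK hμ
  simp only [void_eq_count]
  rw [← lintegral_map (f := fun n : ℕ∞ => if n = 0 then (1 : ℝ≥0∞) else 0) .of_discrete
    (hΦ.measurable_count K hK), h, lintegral_map .of_discrete .of_discrete, poissonMeasure,
    lintegral_sum_measure]
  simp only [lintegral_smul_measure, lintegral_dirac]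
  rw [tsum_eq_single 0]
  · simp [ENNReal.coe_toNNReal_eq_toReal]
  · intro n hn
    simp [hn]

/-- When `K` is void, the count in `B i` equals the count in `B i \ K`. The sets `K` and `B i \ K`
are pairwise disjoint, so independence applies. -/
lemma lintegral_prod_count_mul_void (hΦ : IsPoissonPointProcess Φ μ P) {k : ℕ}
    {B : Fin k → Set E} (hB : ∀ i, MeasurableSet (B i)) (hμB : ∀ i, μ (B i) < ∞)
    (hd : Pairwise fun i j => Disjoint (B i) (B j)) {K : Set E} (hK : MeasurableSet K)
    (hμ : μ K < ∞) :
    ∫⁻ ω, (∏ i, ((Φ ω ∩ B i).encard : ℝ≥0∞)) * void (Φ ω) K ∂P =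
      (∏ i, μ (B i \ K)) * ENNReal.ofReal (Real.exp (-(μ K).toReal)) := by
  let D : Fin (k + 1) → Set E := Fin.cons K fun i => B i \ K
  let g : Fin (k + 1) → ℕ∞ → ℝ≥0∞ :=
    Fin.cons (fun n => if n = 0 then (1 : ℝ≥0∞) else 0) fun _ n => n
  have hD : ∀ i, MeasurableSet (D i) :=
    Fin.cases hK fun i => (hB i).diff hK
  have hDd : Pairwise fun i j => Disjoint (D i) (D j) := by
    intro i j hij
    induction i using Fin.cases with
    | zero =>
      induction j using Fin.cases with
      | zero => exact absurd rfl hij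
      | succ j => exact Set.disjoint_sdiff_right
    | succ i =>
      induction j using Fin.cases with
      | zero => exact Set.disjoint_sdiff_left
      | succ j =>
        exact (hd fun h => hij (congrArg _ h)).mono Set.sdiff_subset Set.sdiff_subset
  have hind := (hΦ.indep_count _ D hD hDd).comp g fun i => .of_discrete
  have key := lintegral_prod_eq_prod_lintegral_of_indepFun Finset.univ _ hind
    fun i => (Measurable.of_discrete (f := g i)).comp (hΦ.measurable_count _ (hD i))
  simp only [Fin.prod_univ_succ, Function.comp_def, D, g, Fin.cons_zero, Fin.cons_succ] at key
  rw [mul_comm (∏ i, μ (B i \ K))]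
  calc _ = ∫⁻ ω, (if (Φ ω ∩ K).encard = 0 then 1 else 0) *
        ∏ i, ((Φ ω ∩ (B i \ K)).encard : ℝ≥0∞) ∂P := by
        refine lintegral_congr fun ω => ?_
        rw [mul_comm, void_eq_count]
        split_ifs with h
        · congr 1
          refine Finset.prod_congr rfl fun i _ => ?_
          congr 2
          rw [Set.encard_eq_zero] at h
          ext x
          simp only [Set.mem_inter_iff, Set.mem_sdiff]
          refine ⟨fun hx => ⟨hx.1, hx.2, fun hxK => ?_⟩, fun hx => ⟨hx.1, hx.2.1⟩⟩
          exact (h ▸ ⟨hx.1, hxK⟩ : x ∈ (∅ : Set E))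
        · simp
    _ = _ := by
        rw [key, ← hΦ.lintegral_void hK hμ]
        congr 1
        · simp only [void_eq_count]
        · exact Finset.prod_congr rfl fun i _ => hΦ.lintegral_count ((hB i).diff hK)
            ((measure_mono Set.sdiff_subset).trans_lt (hμB i))

/-- A π-λ argument in `A`, starting from boxes. Staying inside `Set.univ.pi Q` keeps both measures
finite (almost surely for the random one), which is what the complement step needs.
Almost-everywhere measurability is proved in the same induction because only the counts are assumed
measurable. -/
lemma mecke_void_const [SigmaFinite μ] (hΦ : IsPoissonPointProcess Φ μ P) {k : ℕ}
    {Q : Fin k → Set E} (hQ : ∀ i, MeasurableSet (Q i)) (hμQ : ∀ i, μ (Q i) < ∞)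
    (hd : Pairwise fun i j => Disjoint (Q i) (Q j)) {K : Set E} (hK : MeasurableSet K)
    (hμ : μ K < ∞) {A : Set (Fin k → E)} (hA : MeasurableSet A) :
    AEMeasurable (fun ω => tupleMeasure (Φ ω) k (A ∩ Set.univ.pi Q)) P ∧
    ∫⁻ ω, tupleMeasure (Φ ω) k (A ∩ Set.univ.pi Q) * void (Φ ω) K ∂P =
      Measure.pi (fun _ : Fin k => μ) (A ∩ Set.univ.pi Q ∩ Set.univ.pi fun _ => Kᶜ) *
        ENNReal.ofReal (Real.exp (-(μ K).toReal)) := by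
  have hfin : ∀ᵐ ω ∂P, ∀ i, (Φ ω ∩ Q i).Finite :=
    ae_all_iff.2 fun i => hΦ.ae_finite_count (hQ i) (hμQ i)
  have hR : MeasurableSet (Set.univ.pi Q) := .univ_pi hQ
  have hKk : MeasurableSet (Set.univ.pi fun _ : Fin k => Kᶜ) := .univ_pi fun _ => hK.compl
  have hbox : ∀ C : Fin k → Set E, (∀ i, MeasurableSet (C i)) →
      AEMeasurable (fun ω => tupleMeasure (Φ ω) k (Set.univ.pi C ∩ Set.univ.pi Q)) P ∧
      ∫⁻ ω, tupleMeasure (Φ ω) k (Set.univ.pi C ∩ Set.univ.pi Q) * void (Φ ω) K ∂P =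
        Measure.pi (fun _ : Fin k => μ)
          (Set.univ.pi C ∩ Set.univ.pi Q ∩ Set.univ.pi fun _ => Kᶜ) *
        ENNReal.ofReal (Real.exp (-(μ K).toReal)) := by
    intro C hC
    rw [← Set.pi_inter_distrib]
    have hm : ∀ i, MeasurableSet (C i ∩ Q i) := fun i => (hC i).inter (hQ i)
    have hd' : Pairwise fun i j => Disjoint (C i ∩ Q i) (C j ∩ Q j) := fun i j hij =>
      (hd hij).mono Set.inter_subset_right Set.inter_subset_right
    have hae : ∀ᵐ ω ∂P, tupleMeasure (Φ ω) k (Set.univ.pi fun i => C i ∩ Q i) =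
        ∏ i, ((Φ ω ∩ (C i ∩ Q i)).encard : ℝ≥0∞) := by
      filter_upwards [hfin] with ω hω
      exact tupleMeasure_box hm hd' fun i =>
        (hω i).subset fun x hx => ⟨hx.1, hx.2.2⟩
    refine ⟨⟨_, Finset.measurable_fun_prod _ fun i _ =>
      measurable_natCast_enat.comp (hΦ.measurable_count _ (hm i)), hae⟩, ?_⟩
    rw [lintegral_congr_ae (hae.mono fun ω h => congrArg (· * void (Φ ω) K) h),
      hΦ.lintegral_prod_count_mul_void hm
        (fun i => (measure_mono Set.inter_subset_right).trans_lt (hμQ i)) hd' hK hμ,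
      ← Set.pi_inter_distrib, Measure.pi_pi]
    rfl
  have hRe := hbox (fun _ => Set.univ) fun _ => .univ
  simp only [Set.pi_univ, Set.univ_inter] at hRe
  have hRfin : ∀ᵐ ω ∂P, tupleMeasure (Φ ω) k (Set.univ.pi Q) < ∞ := by
    filter_upwards [hfin] with ω hω
    rw [tupleMeasure_box hQ hd hω]
    refine ENNReal.prod_lt_top fun i _ => ?_
    rw [← (hω i).cast_ncard_eq]
    exact ENNReal.natCast_lt_top _
  have hvm := (hΦ.measurable_void hK).aemeasurable (μ := P)
  have hpifin : Measure.pi (fun _ : Fin k => μ) (Set.univ.pi Q) < ∞ := by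
    rw [Measure.pi_pi]
    exact ENNReal.prod_lt_top fun i _ => hμQ i
  have hIfin : ∀ A : Set (Fin k → E), Measure.pi (fun _ : Fin k => μ)
      (A ∩ Set.univ.pi Q ∩ Set.univ.pi fun _ => Kᶜ) < ∞ := fun A =>
    (measure_mono (Set.inter_subset_left.trans Set.inter_subset_right)).trans_lt hpifin
  induction A, hA using MeasurableSpace.induction_on_inter
    (generateFrom_pi (α := fun _ : Fin k => E)).symm (isPiSystem_pi (α := fun _ : Fin k => E)) with
  | empty => simp [aemeasurable_const]
  | basic t ht =>
    obtain ⟨C, hC, rfl⟩ := ht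
    exact hbox C fun i => hC i trivial
  | compl t ht ih =>
    have hsub : t ∩ Set.univ.pi Q ⊆ Set.univ.pi Q := Set.inter_subset_right
    have hset : tᶜ ∩ Set.univ.pi Q = Set.univ.pi Q \ (t ∩ Set.univ.pi Q) := by
      ext x; simp only [Set.mem_inter_iff, Set.mem_compl_iff, Set.mem_sdiff]; tauto
    have hae : ∀ᵐ ω ∂P, tupleMeasure (Φ ω) k (tᶜ ∩ Set.univ.pi Q) =
        tupleMeasure (Φ ω) k (Set.univ.pi Q) - tupleMeasure (Φ ω) k (t ∩ Set.univ.pi Q) := by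
      filter_upwards [hRfin] with ω hω
      rw [hset, measure_sdiff hsub (ht.inter hR).nullMeasurableSet
        ((measure_mono hsub).trans_lt hω).ne]
    refine ⟨(hRe.1.sub ih.1).congr (hae.mono fun _ h => h.symm), ?_⟩
    have h2 : tᶜ ∩ Set.univ.pi Q ∩ (Set.univ.pi fun _ => Kᶜ) =
        (Set.univ.pi Q ∩ Set.univ.pi fun _ => Kᶜ) \
          (t ∩ Set.univ.pi Q ∩ Set.univ.pi fun _ => Kᶜ) := by
      ext x; simp only [Set.mem_inter_iff, Set.mem_compl_iff, Set.mem_sdiff]; tauto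
    rw [h2, measure_sdiff (by gcongr) ((ht.inter hR).inter hKk).nullMeasurableSet
      (hIfin t).ne, ENNReal.sub_mul fun _ _ => ENNReal.ofReal_ne_top, ← hRe.2, ← ih.2,
      ← lintegral_sub' (f := fun ω => tupleMeasure (Φ ω) k (Set.univ.pi Q) * void (Φ ω) K)
        (g := fun ω => tupleMeasure (Φ ω) k (t ∩ Set.univ.pi Q) * void (Φ ω) K) (ih.1.mul hvm)]
    · refine lintegral_congr_ae ?_
      filter_upwards [hae] with ω hω
      rw [hω, ENNReal.sub_mul fun _ _ => ((void_le_one _ _).trans_lt ENNReal.one_lt_top).ne]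
    · rw [ih.2]
      exact ENNReal.mul_ne_top (hIfin t).ne ENNReal.ofReal_ne_top
    · refine .of_forall fun ω => ?_
      dsimp only
      gcongr
  | iUnion f hfd hfm ih =>
    have hd2 : ∀ L : Set (Fin k → E), Pairwise (Function.onFun Disjoint fun i => f i ∩ L) :=
      fun L i j hij => (hfd hij).mono Set.inter_subset_left Set.inter_subset_left
    have hae : ∀ ω, tupleMeasure (Φ ω) k ((⋃ i, f i) ∩ Set.univ.pi Q) =
        ∑' i, tupleMeasure (Φ ω) k (f i ∩ Set.univ.pi Q) := fun ω => by
      rw [Set.iUnion_inter, measure_iUnion (hd2 _) fun i => (hfm i).inter hR]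
    simp only [hae]
    refine ⟨AEMeasurable.tsum fun i => (ih i).1, ?_⟩
    simp only [← ENNReal.tsum_mul_right]
    rw [lintegral_tsum (f := fun i ω => tupleMeasure (Φ ω) k (f i ∩ Set.univ.pi Q) * void (Φ ω) K)
      fun i => (ih i).1.mul hvm, tsum_congr fun i => (ih i).2,
      ENNReal.tsum_mul_right]
    congr 1
    rw [Set.inter_assoc, Set.iUnion_inter, measure_iUnion (hd2 _) fun i =>
      (hfm i).inter (hR.inter hKk)]
    simp only [Set.inter_assoc]

end IsPoissonPointProcess
end Mecke
-- The Mecke formula for a void set depending on the tuple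
section Mecke

variable {Ω E : Type*} [MeasurableSpace Ω] [MeasurableSpace E]
variable {Φ : Ω → Set E} {μ : Measure E} {P : Measure Ω}

lemma setLIntegral_comp_fintype {X J : Type*} [MeasurableSpace X] [MeasurableSpace J] [Fintype J]
    [DiscreteMeasurableSpace J] (ν : Measure X) {j : X → J} (hj : Measurable j) (A : Set X)
    (g : J → ℝ≥0∞) :
    ∫⁻ x in A, g (j x) ∂ν = ∑ i, g i * ν (A ∩ j ⁻¹' {i}) := by
  rw [← lintegral_map (f := g) .of_discrete hj, lintegral_fintype]
  refine Finset.sum_congr rfl fun i _ => ?_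
  rw [Measure.map_apply hj (.of_discrete), Measure.restrict_apply (hj .of_discrete),
    Set.inter_comm]

namespace IsPoissonPointProcess

/-- The Mecke formula on a box, for a void indicator over a random countable union. -/
lemma mecke_void_box [SigmaFinite μ] (hΦ : IsPoissonPointProcess Φ μ P) {k : ℕ}
    {Q : Fin k → Set E} (hQ : ∀ i, MeasurableSet (Q i)) (hμQ : ∀ i, μ (Q i) < ∞)
    (hd : Pairwise fun i j => Disjoint (Q i) (Q j)) {B : ℕ → Set E} (hB : ∀ j, MeasurableSet (B j))
    {T : ℕ → Set (Fin k → E)} (hT : ∀ j, MeasurableSet (T j)) {K : (Fin k → E) → Set E}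
    (hK : ∀ x, K x = ⋃ j, ⋃ (_ : x ∈ T j), B j) {A : Set (Fin k → E)} (hA : MeasurableSet A)
    (hAQ : A ⊆ Set.univ.pi Q) (hμK : ∀ x ∈ A, μ (K x) < ∞) (hAK : ∀ x ∈ A, ∀ i, x i ∉ K x) :
    AEMeasurable (fun ω => ∫⁻ x in A, void (Φ ω) (K x) ∂tupleMeasure (Φ ω) k) P ∧
    ∫⁻ ω, ∫⁻ x in A, void (Φ ω) (K x) ∂tupleMeasure (Φ ω) k ∂P =
      ∫⁻ x in A, ENNReal.ofReal (Real.exp (-(μ (K x)).toReal)) ∂Measure.pi fun _ => μ := by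
  have hAm : AEMeasurable (fun ω => tupleMeasure (Φ ω) k A) P ∧
      ∫⁻ ω, tupleMeasure (Φ ω) k A ∂P = Measure.pi (fun _ : Fin k => μ) A := by
    have h := hΦ.mecke_void_const hQ hμQ hd (K := ∅) .empty (by simp) hA
    simpa [Set.inter_eq_left.2 hAQ, void] using h
  have hAfin : Measure.pi (fun _ : Fin k => μ) A < ∞ := by
    refine (measure_mono hAQ).trans_lt ?_
    rw [Measure.pi_pi]
    exact ENNReal.prod_lt_top fun i _ => hμQ i
  have hMfin : ∀ᵐ ω ∂P, tupleMeasure (Φ ω) k A < ∞ :=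
    ae_lt_top' hAm.1 (by rw [hAm.2]; exact hAfin.ne)
  -- Keeping only the first `n` pieces `B j` makes the void set depend on `x` through one of
  -- finitely many patterns `p`. It is constant on each level set of `J n`, where `mecke_void_const`
  -- applies, and it increases to `K x`.
  let J : (n : ℕ) → (Fin k → E) → (Fin n → Prop) := fun n x j => x ∈ T j
  let KJ : (n : ℕ) → (Fin n → Prop) → Set E := fun n p => ⋃ j, ⋃ (_ : p j), B j
  have hJ : ∀ n, Measurable (J n) := fun n =>
    measurable_pi_iff.2 fun j => measurableSet_setOfPred.1 (hT j)
  have hKJ : ∀ n p, MeasurableSet (KJ n p) := fun n p =>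
    .iUnion fun j => .iUnion fun _ => hB j
  have hmono : ∀ x, Monotone fun n => KJ n (J n x) := by
    intro x m n hmn y hy
    simp only [KJ, J, Set.mem_iUnion] at hy ⊢
    obtain ⟨j, hj, hy⟩ := hy
    exact ⟨⟨j, j.2.trans_le hmn⟩, hj, hy⟩
  have hKU : ∀ x, K x = ⋃ n, KJ n (J n x) := by
    intro x
    rw [hK]
    ext y
    simp only [KJ, J, Set.mem_iUnion]
    constructor
    · rintro ⟨j, hj, hy⟩
      exact ⟨j + 1, ⟨j, j.lt_succ_self⟩, hj, hy⟩
    · rintro ⟨n, j, hj, hy⟩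
      exact ⟨j, hj, hy⟩
  have hsub : ∀ n x, KJ n (J n x) ⊆ K x := fun n x => by
    rw [hKU x]; exact Set.subset_iUnion (fun n => KJ n (J n x)) n
  have hcell : ∀ n (p : Fin n → Prop),
      AEMeasurable (fun ω => void (Φ ω) (KJ n p) * tupleMeasure (Φ ω) k (A ∩ J n ⁻¹' {p})) P ∧
      ∫⁻ ω, void (Φ ω) (KJ n p) * tupleMeasure (Φ ω) k (A ∩ J n ⁻¹' {p}) ∂P =
        ENNReal.ofReal (Real.exp (-(μ (KJ n p)).toReal)) *
          Measure.pi (fun _ : Fin k => μ) (A ∩ J n ⁻¹' {p}) := by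
    intro n p
    rcases (A ∩ J n ⁻¹' {p}).eq_empty_or_nonempty with he | ⟨x, hxA, hxp⟩
    · simp [he, aemeasurable_const]
    · have hxp : J n x = p := hxp
      have hlt : μ (KJ n p) < ∞ := (measure_mono (hxp ▸ hsub n x)).trans_lt (hμK x hxA)
      have hc := hΦ.mecke_void_const hQ hμQ hd (hKJ n p) hlt
        (hA.inter (hJ n (.singleton p)))
      have h1 : A ∩ J n ⁻¹' {p} ∩ Set.univ.pi Q = A ∩ J n ⁻¹' {p} :=
        Set.inter_eq_left.2 (Set.inter_subset_left.trans hAQ)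
      -- The points of the tuple avoid `K x`, so the restriction to the complement of the void set
      -- costs nothing.
      have h2 : A ∩ J n ⁻¹' {p} ∩ (Set.univ.pi fun _ => (KJ n p)ᶜ) = A ∩ J n ⁻¹' {p} := by
        refine Set.inter_eq_left.2 fun y hy i _ hyi => hAK y hy.1 i (hsub n y ?_)
        rwa [show J n y = p from hy.2]
      rw [h1, h2] at hc
      refine ⟨(hΦ.measurable_void (hKJ n p)).aemeasurable.mul hc.1, ?_⟩
      simp only [mul_comm (void _ _)]
      rw [hc.2, mul_comm]
  have happrox : ∀ n,
      AEMeasurable (fun ω => ∫⁻ x in A, void (Φ ω) (KJ n (J n x)) ∂tupleMeasure (Φ ω) k) P ∧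
      ∫⁻ ω, ∫⁻ x in A, void (Φ ω) (KJ n (J n x)) ∂tupleMeasure (Φ ω) k ∂P =
        ∫⁻ x in A, ENNReal.ofReal (Real.exp (-(μ (KJ n (J n x))).toReal))
          ∂Measure.pi fun _ => μ := by
    intro n
    have h1 : ∀ ω, ∫⁻ x in A, void (Φ ω) (KJ n (J n x)) ∂tupleMeasure (Φ ω) k =
        ∑ p, void (Φ ω) (KJ n p) * tupleMeasure (Φ ω) k (A ∩ J n ⁻¹' {p}) := fun ω =>
      setLIntegral_comp_fintype _ (hJ n) A fun p => void (Φ ω) (KJ n p)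
    simp only [h1, setLIntegral_comp_fintype _ (hJ n) A fun p =>
        ENNReal.ofReal (Real.exp (-(μ (KJ n p)).toReal))]
    refine ⟨Finset.aemeasurable_fun_sum _ fun p _ => (hcell n p).1, ?_⟩
    rw [lintegral_finsetSum' _ fun p _ => (hcell n p).1]
    exact Finset.sum_congr rfl fun p _ => (hcell n p).2
  have hvoid : ∀ S : Set E, ∀ x, Tendsto (fun n => void S (KJ n (J n x))) atTop
      (nhds (void S (K x))) := by
    intro S x
    rcases (S ∩ K x).eq_empty_or_nonempty with h0 | ⟨y, hyS, hyK⟩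
    · refine tendsto_atTop_of_eventually_const (i₀ := 0) fun n _ => ?_
      have h1 : S ∩ KJ n (J n x) = ∅ :=
        Set.subset_eq_empty (Set.inter_subset_inter_right _ (hsub n x)) h0
      rw [void, void, if_pos h0, if_pos h1]
    · have hyK' := hyK
      rw [hKU x] at hyK'
      obtain ⟨m, hm⟩ := Set.mem_iUnion.1 hyK'
      refine tendsto_atTop_of_eventually_const (i₀ := m) fun n hn => ?_
      have h1 : (S ∩ KJ n (J n x)).Nonempty := ⟨y, hyS, hmono x hn hm⟩
      have h2 : (S ∩ K x).Nonempty := ⟨y, hyS, hyK⟩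
      rw [void, void, if_neg h1.ne_empty, if_neg h2.ne_empty]
  have hlim : ∀ᵐ ω ∂P, Tendsto
      (fun n => ∫⁻ x in A, void (Φ ω) (KJ n (J n x)) ∂tupleMeasure (Φ ω) k) atTop
      (nhds (∫⁻ x in A, void (Φ ω) (K x) ∂tupleMeasure (Φ ω) k)) := by
    filter_upwards [hMfin] with ω hω
    -- The constant `1` is integrable here because the box almost surely contains finitely many
    -- tuples.
    refine tendsto_lintegral_of_dominated_convergence (fun _ => 1) (fun n => ?_)
      (fun n => .of_forall fun x => void_le_one _ _) (by simpa using hω.ne)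
      (.of_forall fun x => hvoid _ x)
    exact (Measurable.of_discrete (f := fun p => void (Φ ω) (KJ n p))).comp (hJ n)
  refine ⟨aemeasurable_of_tendsto_metrizable_ae atTop (fun n => (happrox n).1) hlim, ?_⟩
  have hl1 := tendsto_lintegral_of_dominated_convergence' (fun ω => tupleMeasure (Φ ω) k A)
    (fun n => (happrox n).1) (fun n => .of_forall fun ω =>
      (lintegral_mono fun x => void_le_one _ _).trans (by simp)) (by rw [hAm.2]; exact hAfin.ne) hlim
  have hl2 : Tendsto (fun n => ∫⁻ x in A, ENNReal.ofReal (Real.exp (-(μ (KJ n (J n x))).toReal))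
      ∂Measure.pi fun _ => μ) atTop (nhds (∫⁻ x in A,
        ENNReal.ofReal (Real.exp (-(μ (K x)).toReal)) ∂Measure.pi fun _ => μ)) := by
    refine tendsto_lintegral_of_dominated_convergence (fun _ => 1) (fun n => ?_)
      (fun n => .of_forall fun x => ?_) (by simpa using hAfin.ne)
      ((ae_restrict_iff' hA).2 (.of_forall fun x hx => ?_))
    · exact (Measurable.of_discrete (f := fun p =>
        ENNReal.ofReal (Real.exp (-(μ (KJ n p)).toReal)))).comp (hJ n)
    · exact ENNReal.ofReal_le_one.2 (Real.exp_le_one_iff.2 (by simp))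
    · refine ENNReal.tendsto_ofReal ((Real.continuous_exp.tendsto _).comp (Tendsto.neg ?_))
      refine (ENNReal.tendsto_toReal (hμK x hx).ne).comp ?_
      rw [hKU x]
      exact tendsto_measure_iUnion_atTop (hmono x)
  exact tendsto_nhds_unique hl1 (by simpa only [(happrox _).2] using hl2)

lemma exists_box_cover [TopologicalSpace E] [T2Space E] [SecondCountableTopology E] [BorelSpace E]
    (μ : Measure E) [IsLocallyFiniteMeasure μ] (k : ℕ) :
    ∃ R : ℕ → Set (Fin k → E),
      {x | Function.Injective x} ⊆ ⋃ n, R n ∧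
      ∀ n, R n = ∅ ∨ ∃ Q : Fin k → Set E, R n = Set.univ.pi Q ∧ (∀ i, MeasurableSet (Q i)) ∧
        (∀ i, μ (Q i) < ∞) ∧ Pairwise fun i j => Disjoint (Q i) (Q j) := by
  let b := TopologicalSpace.countableBasis E
  have hb := TopologicalSpace.isBasis_countableBasis E
  have : Countable b := (TopologicalSpace.countable_countableBasis E).to_subtype
  -- Only countably many boxes have sides in a countable basis. Since the space is Hausdorff and the
  -- measure locally finite, those with disjoint sides of finite measure already cover the injective
  -- tuples.
  let ι := {Q : Fin k → b // (∀ i, μ (Q i) < ∞) ∧ Pairwise fun i j => Disjoint (Q i).1 (Q j).1}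
  let F : ι → Set (Fin k → E) := fun Q => Set.univ.pi fun i => ((Q.1 i : b) : Set E)
  have : Encodable ι := Encodable.ofCountable ι
  refine ⟨fun n => ⋃ Q ∈ Encodable.decode₂ ι n, F Q, ?_, fun n => ?_⟩
  · rw [Encodable.iUnion_decode₂]
    intro x hx
    obtain ⟨U, hU, hUd⟩ := (Set.finite_range x).t2_separation
    have h1 : ∀ i, ∃ V ∈ b, x i ∈ V ∧ V ⊆ U (x i) ∧ μ V < ∞ := by
      intro i
      obtain ⟨W, hxW, hWo, hWμ⟩ := μ.exists_isOpen_measure_lt_top (x i)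
      obtain ⟨V, hV, hxV, hVs⟩ := hb.exists_subset_of_mem_open
        (show x i ∈ U (x i) ∩ W from ⟨(hU _).1, hxW⟩) ((hU _).2.inter hWo)
      exact ⟨V, hV, hxV, hVs.trans Set.inter_subset_left,
        (measure_mono (hVs.trans Set.inter_subset_right)).trans_lt hWμ⟩
    choose V hV hxV hVU hVμ using h1
    refine Set.mem_iUnion.2 ⟨⟨fun i => ⟨V i, hV i⟩, hVμ, fun i j hij => ?_⟩, fun i _ => hxV i⟩
    exact (hUd ⟨i, rfl⟩ ⟨j, rfl⟩ fun h => hij (hx h)).mono (hVU i) (hVU j)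
  · rcases h : Encodable.decode₂ ι n with _ | Q
    · left; simp [h]
    · right
      refine ⟨fun i => (Q.1 i : b), by simp [F, h], fun i => ?_, Q.2.1, Q.2.2⟩
      exact (hb.isOpen (Q.1 i).2).measurableSet

/-- The multivariate Mecke formula for a void indicator over a random countable union. -/
theorem mecke_void [TopologicalSpace E] [T2Space E] [SecondCountableTopology E] [BorelSpace E]
    [IsLocallyFiniteMeasure μ] (hΦ : IsPoissonPointProcess Φ μ P) {k : ℕ}
    {B : ℕ → Set E} (hB : ∀ j, MeasurableSet (B j))
    {T : ℕ → Set (Fin k → E)} (hT : ∀ j, MeasurableSet (T j)) {K : (Fin k → E) → Set E}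
    (hK : ∀ x, K x = ⋃ j, ⋃ (_ : x ∈ T j), B j) {A : Set (Fin k → E)} (hA : MeasurableSet A)
    (hinj : ∀ x ∈ A, Function.Injective x) (hμK : ∀ x ∈ A, μ (K x) < ∞)
    (hAK : ∀ x ∈ A, ∀ i, x i ∉ K x) :
    AEMeasurable (fun ω => ∫⁻ x in A, void (Φ ω) (K x) ∂tupleMeasure (Φ ω) k) P ∧
    ∫⁻ ω, ∫⁻ x in A, void (Φ ω) (K x) ∂tupleMeasure (Φ ω) k ∂P =
      ∫⁻ x in A, ENNReal.ofReal (Real.exp (-(μ (K x)).toReal)) ∂Measure.pi fun _ => μ := by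
  obtain ⟨R, hcov, hR⟩ := exists_box_cover μ k
  have hRm : ∀ n, MeasurableSet (R n) := by
    intro n
    rcases hR n with h | ⟨Q, h, hQ, -⟩
    · rw [h]; exact .empty
    · rw [h]; exact .univ_pi hQ
  have hDm : ∀ n, MeasurableSet (A ∩ disjointed R n) := fun n =>
    hA.inter (.disjointed hRm n)
  have hDd : Pairwise (Function.onFun Disjoint fun n => A ∩ disjointed R n) := fun m n hmn =>
    (disjoint_disjointed R hmn).mono Set.inter_subset_right Set.inter_subset_right
  have hAU : A = ⋃ n, A ∩ disjointed R n := by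
    rw [← Set.inter_iUnion, iUnion_disjointed]
    exact (Set.inter_eq_left.2 (subset_trans hinj hcov)).symm
  have hpiece : ∀ n, AEMeasurable
        (fun ω => ∫⁻ x in A ∩ disjointed R n, void (Φ ω) (K x) ∂tupleMeasure (Φ ω) k) P ∧
      ∫⁻ ω, ∫⁻ x in A ∩ disjointed R n, void (Φ ω) (K x) ∂tupleMeasure (Φ ω) k ∂P =
        ∫⁻ x in A ∩ disjointed R n, ENNReal.ofReal (Real.exp (-(μ (K x)).toReal))
          ∂Measure.pi fun _ => μ := by
    intro n
    have hs : A ∩ disjointed R n ⊆ R n := Set.inter_subset_right.trans (disjointed_subset R n)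
    rcases hR n with h | ⟨Q, h, hQ, hQμ, hQd⟩
    · have : A ∩ disjointed R n = ∅ := Set.subset_eq_empty hs h
      simp [this, aemeasurable_const]
    · exact hΦ.mecke_void_box hQ hQμ hQd hB hT hK (hDm n) (h ▸ hs) (fun x hx => hμK x hx.1)
        fun x hx => hAK x hx.1
  rw [hAU]
  simp only [lintegral_iUnion hDm hDd]
  refine ⟨AEMeasurable.tsum fun n => (hpiece n).1, ?_⟩
  rw [lintegral_tsum fun n => (hpiece n).1]
  exact tsum_congr fun n => (hpiece n).2

end IsPoissonPointProcess
end Mecke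
-- Pointy vertices as tuples of tight nuclei
section Geometry

variable {d : ℕ}

lemma norm_le_norm_sub_iff (y c : Space d) : ‖c‖ ≤ ‖y - c‖ ↔ ⟪y, c⟫ ≤ ‖y‖ ^ 2 / 2 := by
  rw [← abs_of_nonneg (norm_nonneg c), ← abs_of_nonneg (norm_nonneg (y - c)), ← sq_le_sq,
    norm_sub_sq_real]
  constructor <;> intro h <;> linarith

lemma norm_sub_eq_norm_iff (y c : Space d) : ‖y - c‖ = ‖c‖ ↔ ⟪y, c⟫ = ‖y‖ ^ 2 / 2 := by
  rw [← sq_eq_sq₀ (norm_nonneg _) (norm_nonneg _), norm_sub_sq_real]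
  constructor <;> intro h <;> linarith

lemma mem_zeroNucleusCell_iff {S : Set (Space d)} {y : Space d} :
    y ∈ zeroNucleusCell S ↔ ∀ s ∈ S, ⟪s, y⟫ ≤ ‖s‖ ^ 2 / 2 := by
  simp only [zeroNucleusCell, voronoiCell, Set.union_singleton, Set.mem_ofPred_eq,
    Set.forall_mem_insert, zero_sub, norm_neg, norm_le_norm_sub_iff]
  simp

lemma mem_zeroNucleusCell_iff_void {S : Set (Space d)} {c : Space d} :
    c ∈ zeroNucleusCell S ↔ S ∩ Metric.ball c ‖c‖ = ∅ := by
  simp only [mem_zeroNucleusCell_iff, ← norm_le_norm_sub_iff, Set.eq_empty_iff_forall_notMem,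
    Set.mem_inter_iff, mem_ball_iff_norm, not_and, not_lt]

/-- `x` is a linearly independent tuple, `c` is the center of a sphere through `0` and the points
of `x`, and `c` lies in the interior of the cone spanned by `x`. -/
def IsPointyTuple (x : Fin d → Space d) (c : Space d) : Prop :=
  LinearIndependent ℝ x ∧ (∀ i, ‖x i - c‖ = ‖c‖) ∧
    ∃ w : Fin d → ℝ, (∀ i, 0 < w i) ∧ ∑ i, w i • x i = c

lemma span_range_eq_top {x : Fin d → Space d} (hx : LinearIndependent ℝ x) :
    Submodule.span ℝ (Set.range x) = ⊤ :=
  hx.span_eq_top_of_card_eq_finrank' (by simp)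

lemma eq_zero_of_inner_eq_zero {T : Set (Space d)} (hT : Submodule.span ℝ T = ⊤) {v : Space d}
    (h : ∀ y ∈ T, ⟪y, v⟫ = 0) : v = 0 := by
  have h1 : v ∈ (Submodule.span ℝ T)ᗮ := by
    rw [Submodule.mem_orthogonal]
    intro u hu
    induction hu using Submodule.span_induction with
    | mem x hx => exact h x hx
    | zero => simp
    | add x y _ _ hx hy => rw [inner_add_left, hx, hy, add_zero]
    | smul a x _ hx => rw [inner_smul_left, hx, mul_zero]
  rwa [hT, Submodule.top_orthogonal_eq_bot, Submodule.mem_bot] at h1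

lemma eq_of_inner_eq {x : Fin d → Space d} (hx : LinearIndependent ℝ x) {u v : Space d}
    (h : ∀ i, ⟪x i, u⟫ = ⟪x i, v⟫) : u = v := by
  rw [← sub_eq_zero]
  refine eq_zero_of_inner_eq_zero (span_range_eq_top hx) ?_
  rintro _ ⟨i, rfl⟩
  rw [inner_sub_right, h, sub_self]

lemma exists_inner_eq {x : Fin d → Space d} (hx : LinearIndependent ℝ x) (f : Fin d → ℝ) :
    ∃ h : Space d, ∀ i, ⟪x i, h⟫ = f i := by
  let b := Module.Basis.mk hx (span_range_eq_top hx).ge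
  refine ⟨(InnerProductSpace.toDual ℝ (Space d)).symm
    (LinearMap.toContinuousLinearMap (b.constr ℝ f)), fun i => ?_⟩
  rw [real_inner_comm, InnerProductSpace.toDual_symm_apply]
  have : x i = b i := by simp [b]
  rw [this]
  simp

lemma circumcenter_unique {x : Fin d → Space d} (hx : LinearIndependent ℝ x) {c c' : Space d}
    (h : ∀ i, ‖x i - c‖ = ‖c‖) (h' : ∀ i, ‖x i - c'‖ = ‖c'‖) : c = c' :=
  eq_of_inner_eq hx fun i => by
    rw [(norm_sub_eq_norm_iff _ _).1 (h i), (norm_sub_eq_norm_iff _ _).1 (h' i)]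

/-- A constraint that is tight inside a segment of the cell is tight at both ends, and `d`
independent linear equations determine a point. -/
lemma mem_extremePoints_of_tight {S : Set (Space d)} {c : Space d} (hc : c ∈ zeroNucleusCell S)
    {x : Fin d → Space d} (hx : LinearIndependent ℝ x) (hxS : ∀ i, x i ∈ S)
    (hxc : ∀ i, ‖x i - c‖ = ‖c‖) : c ∈ (zeroNucleusCell S).extremePoints ℝ := by
  refine mem_extremePoints.2 ⟨hc, fun a ha b hb hab => ?_⟩
  obtain ⟨p, q, hp, hq, hpq, rfl⟩ := hab
  have key : ∀ i, ⟪x i, a⟫ = ‖x i‖ ^ 2 / 2 ∧ ⟪x i, b⟫ = ‖x i‖ ^ 2 / 2 := by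
    intro i
    have h1 := mem_zeroNucleusCell_iff.1 ha _ (hxS i)
    have h2 := mem_zeroNucleusCell_iff.1 hb _ (hxS i)
    have h3 := (norm_sub_eq_norm_iff _ _).1 (hxc i)
    rw [inner_add_right, real_inner_smul_right, real_inner_smul_right] at h3
    have hq' : q = 1 - p := by linarith
    subst hq'
    constructor <;> nlinarith
  have h3 := fun i => (norm_sub_eq_norm_iff _ _).1 (hxc i)
  exact ⟨eq_of_inner_eq hx fun i => by rw [(key i).1, h3], 
    eq_of_inner_eq hx fun i => by rw [(key i).2, h3]⟩

/-- The quantitative form of injectivity of `h ↦ (w i * ⟪x i, h⟫)`; it gives the linear decay rate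
of the norm at a pointy vertex. -/
lemma exists_sum_abs_inner_ge {x : Fin d → Space d} (hx : LinearIndependent ℝ x)
    {w : Fin d → ℝ} (hw : ∀ i, 0 < w i) :
    ∃ δ > 0, ∀ h : Space d, δ * ‖h‖ ≤ ∑ i, w i * |⟪x i, h⟫| := by
  let L : Space d →ₗ[ℝ] (Fin d → ℝ) :=
    LinearMap.pi fun i => w i • (innerₛₗ ℝ (x i))
  have hL : LinearMap.ker L = ⊥ := by
    rw [LinearMap.ker_eq_bot']
    intro v hv
    refine eq_of_inner_eq hx fun i => ?_
    have := congrFun hv i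
    simpa [L, (hw i).ne'] using this
  obtain ⟨C, hC, hLC⟩ := L.exists_antilipschitzWith hL
  refine ⟨(C : ℝ)⁻¹, by positivity, fun h => ?_⟩
  have h1 := hLC.le_mul_dist h 0
  rw [map_zero, dist_zero_right, dist_zero_right] at h1
  have h2 : ‖L h‖ ≤ ∑ i, w i * |⟪x i, h⟫| := by
    refine (pi_norm_le_iff_of_nonneg (Finset.sum_nonneg fun i _ =>
      mul_nonneg (hw i).le (abs_nonneg _))).2 fun i => ?_
    have : ‖L h i‖ = w i * |⟪x i, h⟫| := by
      simp [L, abs_of_pos (hw i)]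
    rw [this]
    exact Finset.single_le_sum (f := fun i => w i * |⟪x i, h⟫|)
      (fun i _ => mul_nonneg (hw i).le (abs_nonneg _)) (Finset.mem_univ i)
  rw [inv_mul_le_iff₀ (by positivity)]
  exact h1.trans (by gcongr)

/-- With `h = y - c`, the first-order term `2 * ⟪c, h⟫` of `‖c + h‖ ^ 2` is at most `-2 * δ * ‖h‖`
inside the cell, and beats `‖h‖ ^ 2` once `‖h‖ < δ`. -/
lemma isLocalMaxOn_norm_of_pointy {S : Set (Space d)} {c : Space d}
    {x : Fin d → Space d} (hx : IsPointyTuple x c) (hxS : ∀ i, x i ∈ S) :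
    IsLocalMaxOn (fun y : Space d => ‖y‖) (zeroNucleusCell S) c := by
  obtain ⟨hli, hxc, w, hw, hwc⟩ := hx
  obtain ⟨δ, hδ, hδw⟩ := exists_sum_abs_inner_ge hli hw
  have hev : ∀ᶠ y in nhdsWithin c (zeroNucleusCell S), y ∈ Metric.ball c δ :=
    mem_nhdsWithin_of_mem_nhds (Metric.ball_mem_nhds c hδ)
  filter_upwards [hev, self_mem_nhdsWithin] with y hy hyS
  have h1 : ∀ i, ⟪x i, y - c⟫ ≤ 0 := fun i => by
    rw [inner_sub_right, (norm_sub_eq_norm_iff _ _).1 (hxc i)]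
    linarith [mem_zeroNucleusCell_iff.1 hyS _ (hxS i)]
  have h2 : ⟪c, y - c⟫ = -∑ i, w i * |⟪x i, y - c⟫| := by
    rw [← Finset.sum_neg_distrib]
    conv_lhs => rw [← hwc, sum_inner]
    refine Finset.sum_congr rfl fun i _ => ?_
    rw [real_inner_smul_left, abs_of_nonpos (h1 i), hwc]
    ring
  have h3 := hδw (y - c)
  have h4 : ‖y - c‖ < δ := mem_ball_iff_norm.1 hy
  have h5 : ‖y‖ ^ 2 = ‖c‖ ^ 2 + 2 * ⟪c, y - c⟫ + ‖y - c‖ ^ 2 := by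
    rw [← norm_add_sq_real, add_sub_cancel]
  have h6 : ‖y‖ ^ 2 ≤ ‖c‖ ^ 2 := by nlinarith [norm_nonneg (y - c)]
  exact (sq_le_sq₀ (norm_nonneg _) (norm_nonneg _)).1 h6

/-- Near `c`, only the constraints that are tight at `c` matter. -/
lemma eventually_mem_zeroNucleusCell {S : Set (Space d)}
    (hS : ∀ r, (S ∩ Metric.closedBall 0 r).Finite) {c : Space d} (hc : c ∈ zeroNucleusCell S) :
    ∀ᶠ z in nhds c, (∀ y ∈ S, ‖y - c‖ = ‖c‖ → ⟪y, z⟫ ≤ ‖y‖ ^ 2 / 2) → z ∈ zeroNucleusCell S := by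
  -- Nuclei outside this ball cannot cut the unit ball around `c`: there `⟪y, z⟫ ≤ ‖y‖ * (‖c‖ + 1) ≤
  -- ‖y‖ ^ 2 / 2`. Only finitely many nuclei remain, and the inactive ones stay inactive nearby.
  have h1 : ∀ᶠ z in nhds c, ∀ y ∈ S ∩ Metric.closedBall 0 (2 * ‖c‖ + 2),
      ‖y - c‖ ≠ ‖c‖ → ⟪y, z⟫ < ‖y‖ ^ 2 / 2 := by
    refine (eventually_all_finite (hS _)).2 fun y hy => ?_
    by_cases hyc : ‖y - c‖ = ‖c‖
    · exact .of_forall fun z h => absurd hyc h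
    · have hlt : ⟪y, c⟫ < ‖y‖ ^ 2 / 2 :=
        lt_of_le_of_ne (mem_zeroNucleusCell_iff.1 hc y hy.1) fun h =>
          hyc ((norm_sub_eq_norm_iff _ _).2 h)
      have hcont : ContinuousAt (fun z : Space d => ⟪y, z⟫) c := by fun_prop
      exact (hcont.eventually_lt continuousAt_const hlt).mono fun z hz _ => hz
  filter_upwards [h1, Metric.ball_mem_nhds c one_pos] with z hz hzc htight
  refine mem_zeroNucleusCell_iff.2 fun y hy => ?_
  by_cases hyc : ‖y - c‖ = ‖c‖
  · exact htight y hy hyc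
  by_cases hyb : ‖y‖ ≤ 2 * ‖c‖ + 2
  · exact (hz y ⟨hy, by simpa using hyb⟩ hyc).le
  · have h2 : ‖z‖ ≤ ‖c‖ + 1 := by
      have := norm_add_le c (z - c)
      rw [add_sub_cancel] at this
      linarith [mem_ball_iff_norm.1 hzc]
    have h3 := real_inner_le_norm y z
    nlinarith [norm_nonneg y, norm_nonneg z]

lemma eventually_add_smul_mem {S : Set (Space d)}
    (hS : ∀ r, (S ∩ Metric.closedBall 0 r).Finite) {c : Space d} (hc : c ∈ zeroNucleusCell S)
    {h : Space d} (hh : ∀ y ∈ S, ‖y - c‖ = ‖c‖ → ⟪y, h⟫ ≤ 0) :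
    ∀ᶠ ε : ℝ in nhdsWithin 0 (Set.Ioi 0), c + ε • h ∈ zeroNucleusCell S := by
  have hcont : Tendsto (fun ε : ℝ => c + ε • h) (nhdsWithin 0 (Set.Ioi 0)) (nhds c) := by
    have : Continuous fun ε : ℝ => c + ε • h := by fun_prop
    have h0 := this.tendsto 0
    simp only [zero_smul, add_zero] at h0
    exact h0.mono_left nhdsWithin_le_nhds
  filter_upwards [hcont.eventually (eventually_mem_zeroNucleusCell hS hc),
    self_mem_nhdsWithin] with ε hε hpos
  refine hε fun y hy hyc => ?_
  rw [inner_add_right, real_inner_smul_right, (norm_sub_eq_norm_iff _ _).1 hyc]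
  have hpos : 0 < ε := hpos
  nlinarith [hh y hy hyc]

/-- A nonzero vector orthogonal to all tight nuclei could be followed in both directions inside the
cell, making `c` a midpoint. -/
lemma span_tight_eq_top {S : Set (Space d)}
    (hS : ∀ r, (S ∩ Metric.closedBall 0 r).Finite) {c : Space d}
    (hc : c ∈ (zeroNucleusCell S).extremePoints ℝ) :
    Submodule.span ℝ {y | y ∈ S ∧ ‖y - c‖ = ‖c‖} = ⊤ := by
  by_contra hne
  obtain ⟨v, hv, hv0⟩ := Submodule.exists_mem_ne_zero_of_ne_bot
    (fun h => hne (Submodule.orthogonal_eq_bot_iff.1 h))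
  have hz : ∀ y ∈ S, ‖y - c‖ = ‖c‖ → ⟪y, v⟫ = 0 := fun y hy hyc =>
    hv y (Submodule.subset_span ⟨hy, hyc⟩)
  obtain ⟨ε, ⟨h1, h2⟩, hε⟩ := (((eventually_add_smul_mem hS hc.1 (h := v)
    fun y hy hyc => (hz y hy hyc).le).and (eventually_add_smul_mem hS hc.1 (h := -v)
    fun y hy hyc => by rw [inner_neg_right, hz y hy hyc, neg_zero])).and
    self_mem_nhdsWithin).exists
  have hε : 0 < ε := hε
  have := (mem_extremePoints.1 hc).2 _ h1 _ h2
    ⟨1 / 2, 1 / 2, by norm_num, by norm_num, by norm_num, by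
      rw [smul_neg, smul_add, smul_add, smul_neg]
      module⟩
  have h3 : ε • v = 0 := by simpa using this.1
  exact hv0 ((smul_eq_zero.1 h3).resolve_left hε.ne')

/-- A basis extracted from the tight nuclei contains, by `hgp`, all of them. Its edge directions
therefore point into the cell, and local maximality along each one forces the corresponding
coefficient of `c` to be positive. -/
lemma exists_isPointyTuple {S : Set (Space d)}
    (hS : ∀ r, (S ∩ Metric.closedBall 0 r).Finite)
    (hgp : ∀ x ∈ injTuples S d, ∀ c, LinearIndependent ℝ x → (∀ i, ‖x i - c‖ = ‖c‖) →
      ∀ y ∈ S, ‖y - c‖ = ‖c‖ → y ∈ Set.range x) {c : Space d} (hc : c ∈ pointyVertices S) :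
    ∃ x ∈ injTuples S d, IsPointyTuple x c := by
  obtain ⟨hce, hcm⟩ := hc
  obtain ⟨b, hbT, hbs, hbi⟩ := exists_linearIndependent ℝ {y | y ∈ S ∧ ‖y - c‖ = ‖c‖}
  rw [span_tight_eq_top hS hce] at hbs
  let B : Module.Basis b ℝ (Space d) := Module.Basis.mk hbi (by simp [hbs])
  let e : Fin d ≃ b := ((EuclideanSpace.basisFun (Fin d) ℝ).toBasis.indexEquiv B)
  let x : Fin d → Space d := fun i => e i
  have hxS : ∀ i, x i ∈ S := fun i => (hbT (e i).2).1
  have hxc : ∀ i, ‖x i - c‖ = ‖c‖ := fun i => (hbT (e i).2).2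
  have hxi : LinearIndependent ℝ x := hbi.comp e e.injective
  have hxt : x ∈ injTuples S d := ⟨hxi.injective, hxS⟩
  refine ⟨x, hxt, hxi, hxc, ?_⟩
  obtain ⟨w, hw⟩ : ∃ w : Fin d → ℝ, ∑ i, w i • x i = c := by
    have : c ∈ Submodule.span ℝ (Set.range x) := by rw [span_range_eq_top hxi]; trivial
    exact (Submodule.mem_span_range_iff_exists_fun ℝ).1 this
  refine ⟨w, fun k => ?_, hw⟩
  by_contra hk
  -- The edge that leaves only the `k`-th facet. Along it `⟪c, h⟫ = -w k`, so `w k ≤ 0` would make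
  -- the norm strictly increase, even for `w k = 0` because of the second-order term.
  obtain ⟨h, hh⟩ := exists_inner_eq hxi (fun i => if i = k then -1 else 0)
  have hh0 : h ≠ 0 := by
    rintro rfl
    simpa using hh k
  have hmem := eventually_add_smul_mem hS hce.1 (h := h) fun y hy hyc => by
    obtain ⟨i, rfl⟩ := hgp x hxt c hxi hxc y hy hyc
    rw [hh]
    split_ifs <;> norm_num
  have hcont : Tendsto (fun ε : ℝ => c + ε • h) (nhdsWithin 0 (Set.Ioi 0))
      (nhdsWithin c (zeroNucleusCell S)) := by
    refine tendsto_nhdsWithin_iff.2 ⟨?_, hmem⟩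
    have : Continuous fun ε : ℝ => c + ε • h := by fun_prop
    have h0 := this.tendsto 0
    simp only [zero_smul, add_zero] at h0
    exact h0.mono_left nhdsWithin_le_nhds
  obtain ⟨ε, hle, hε⟩ := ((hcont.eventually hcm).and self_mem_nhdsWithin).exists
  have hε : 0 < ε := hε
  have hch : 0 ≤ ⟪c, h⟫ := by
    rw [← hw, sum_inner, Finset.sum_eq_single k]
    · rw [real_inner_smul_left, hh, if_pos rfl]
      linarith
    · intro i _ hik
      rw [real_inner_smul_left, hh, if_neg hik, mul_zero]
    · simp
  have h1 : ‖c + ε • h‖ ^ 2 = ‖c‖ ^ 2 + 2 * (ε * ⟪c, h⟫) + (ε * ‖h‖) ^ 2 := by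
    rw [norm_add_sq_real, real_inner_smul_right, norm_smul, Real.norm_of_nonneg hε.le]
  have h2 : ‖c + ε • h‖ ^ 2 ≤ ‖c‖ ^ 2 :=
    (sq_le_sq₀ (norm_nonneg _) (norm_nonneg _)).2 hle
  have h3 : 0 < ε * ‖h‖ := mul_pos hε (norm_pos_iff.2 hh0)
  nlinarith [mul_nonneg hε.le hch]

lemma IsPointyTuple.comp_perm {x : Fin d → Space d} {c : Space d} (hx : IsPointyTuple x c)
    (σ : Equiv.Perm (Fin d)) : IsPointyTuple (x ∘ σ) c := by
  obtain ⟨hli, hxc, w, hw, hwc⟩ := hx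
  refine ⟨hli.comp σ σ.injective, fun i => hxc _, w ∘ σ, fun i => hw _, ?_⟩
  rw [← hwc]
  exact Equiv.sum_comp σ fun i => w i • x i

/-- The pointy tuples of points of `S` whose ball is void and whose center is at distance at least
`t`. -/
def voidPointyTuples (S : Set (Space d)) (t : ℝ) : Set (Fin d → Space d) :=
  {x | x ∈ injTuples S d ∧ ∃ c, IsPointyTuple x c ∧ t ≤ ‖c‖ ∧ S ∩ Metric.ball c ‖c‖ = ∅}

theorem encard_voidPointyTuples {S : Set (Space d)}
    (hS : ∀ r, (S ∩ Metric.closedBall 0 r).Finite)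
    (hgp : ∀ x ∈ injTuples S d, ∀ c, LinearIndependent ℝ x → (∀ i, ‖x i - c‖ = ‖c‖) →
      ∀ y ∈ S, ‖y - c‖ = ‖c‖ → y ∈ Set.range x) (t : ℝ) :
    (voidPointyTuples S t).encard = (d ! : ℕ∞) * (farPointyVertices S t).encard := by
  have hex : ∀ c : farPointyVertices S t, ∃ x ∈ injTuples S d, IsPointyTuple x c.1 := fun c =>
    exists_isPointyTuple hS hgp c.2.1
  choose x0 hx0 hp0 using hex
  -- Each vertex determines its set of tight nuclei and conversely, so its tuples are exactly the
  -- `d!` orderings of a chosen one.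
  let F : Equiv.Perm (Fin d) × farPointyVertices S t → voidPointyTuples S t := fun p =>
    ⟨x0 p.2 ∘ p.1, ⟨(hx0 p.2).1.comp p.1.injective, fun i => (hx0 p.2).2 _⟩, p.2,
      (hp0 p.2).comp_perm p.1, p.2.2.2, mem_zeroNucleusCell_iff_void.1 p.2.2.1.1.1⟩
  have hF : Function.Bijective F := by
    constructor
    · rintro ⟨σ, c⟩ ⟨σ', c'⟩ h
      have h : x0 c ∘ σ = x0 c' ∘ σ' := congrArg Subtype.val h
      have hcc : c = c' := Subtype.ext (circumcenter_unique ((hp0 c).comp_perm σ).1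
        ((hp0 c).comp_perm σ).2.1 (h ▸ ((hp0 c').comp_perm σ').2.1))
      subst hcc
      congr 1
      ext i
      exact congrArg _ ((hx0 c).1 (congrFun h i))
    · rintro ⟨x, hx, c, hxc, ht, hv⟩
      have hcell := mem_zeroNucleusCell_iff_void.2 hv
      let c' : farPointyVertices S t := ⟨c, ⟨mem_extremePoints_of_tight hcell hxc.1 hx.2 hxc.2.1,
        isLocalMaxOn_norm_of_pointy hxc hx.2⟩, ht⟩
      have hr : ∀ i, ∃ j, x0 c' j = x i := fun i =>
        hgp _ (hx0 c') c (hp0 c').1 (hp0 c').2.1 _ (hx.2 i) (hxc.2.1 i)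
      choose σ hσ using hr
      have hσi : Function.Injective σ := fun i j hij => hx.1 (by rw [← hσ, ← hσ, hij])
      refine ⟨⟨Equiv.ofBijective σ (Finite.injective_iff_bijective.1 hσi), c'⟩, ?_⟩
      exact Subtype.ext (funext hσ)
  have h1 := ENat.card_congr (Equiv.ofBijective F hF)
  rw [ENat.card_prod] at h1
  rw [Set.encard, Set.encard, ← h1]
  congr 1
  simp [Fintype.card_perm]

end Geometry
-- Product measures with densities
section PiDensity

lemma lintegral_fin_prod {α : Type*} [MeasurableSpace α] {n : ℕ} (μ : Fin n → Measure α)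
    [∀ i, SigmaFinite (μ i)] {f : Fin n → α → ℝ≥0∞} (hf : ∀ i, Measurable (f i)) :
    ∫⁻ x, ∏ i, f i (x i) ∂Measure.pi μ = ∏ i, ∫⁻ x, f i x ∂μ i := by
  induction n with
  | zero => simp
  | succ n ih =>
    have h := (measurePreserving_piFinSuccAbove μ 0).symm
    have hm : Measurable fun x : Fin (n + 1) → α => ∏ i, f i (x i) :=
      Finset.measurable_fun_prod _ fun i _ => (hf i).comp (measurable_pi_apply i)
    rw [← h.lintegral_comp hm, Fin.prod_univ_succ, ← ih (fun i => μ i.succ)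
      (fun i => hf i.succ)]
    simp only [Fin.prod_univ_succ]
    have := lintegral_prod_mul (μ := μ 0) (ν := Measure.pi fun i : Fin n => μ i.succ)
      (f := f 0) (g := fun x => ∏ i, f i.succ (x i)) (hf 0).aemeasurable
      (Finset.measurable_fun_prod _ fun i _ =>
        (hf i.succ).comp (measurable_pi_apply i)).aemeasurable
    rw [← this]
    rfl

lemma pi_withDensity {α : Type*} [MeasurableSpace α] {n : ℕ} (μ : Measure α)
    [SigmaFinite μ] {f : α → ℝ≥0∞} (hf : Measurable f) [SigmaFinite (μ.withDensity f)] :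
    Measure.pi (fun _ : Fin n => μ.withDensity f) =
      (Measure.pi fun _ : Fin n => μ).withDensity fun x => ∏ i, f (x i) := by
  refine Measure.pi_eq fun s hs => ?_
  rw [withDensity_apply _ (.univ_pi hs), Measure.restrict_pi_pi,
    lintegral_fin_prod _ fun _ => hf]
  exact Finset.prod_congr rfl fun i _ => (withDensity_apply _ (hs i)).symm

end PiDensity

/-! ### Polar coordinates, for one point and for tuples -/

section Polar

variable {d : ℕ}

/-- The surface measure of the unit sphere. -/
noncomputable abbrev surface (d : ℕ) : Measure (Sphere d) := (volume : Measure (Space d)).toSphere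

/-- The radial measure `r ^ (d - 1) dr` on `(0, ∞)`. -/
noncomputable def radial (d : ℕ) : Measure ℝ :=
  (volume.restrict (Set.Ioi 0)).withDensity fun r => ENNReal.ofReal (r ^ (d - 1))

instance : SigmaFinite (radial d) := by
  unfold radial
  infer_instance

lemma map_val_volumeIoiPow (n : ℕ) : (Measure.volumeIoiPow n).map Subtype.val =
    (volume.restrict (Set.Ioi (0 : ℝ))).withDensity fun r => ENNReal.ofReal (r ^ n) := by
  ext s hs
  have hm : Measurable fun r : ℝ => ENNReal.ofReal (r ^ n) := by fun_prop
  rw [Measure.map_apply measurable_subtype_coe hs, Measure.volumeIoiPow,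
    withDensity_apply _ (measurable_subtype_coe hs), withDensity_apply _ hs,
    setLIntegral_subtype measurableSet_Ioi _ fun r : ℝ => ENNReal.ofReal (r ^ n),
    Subtype.image_preimage_coe, Measure.restrict_restrict hs, Set.inter_comm]

/-- The radial part is taken on all of `ℝ`, with a measure carried by `(0, ∞)`, so that products
over several points avoid subtypes. -/
lemma measurePreserving_polar (hd : 1 ≤ d) :
    MeasurePreserving (fun p : Sphere d × ℝ => p.2 • (p.1 : Space d))
      ((surface d).prod (radial d)) volume := by
  have : Nonempty (Fin d) := ⟨⟨0, hd⟩⟩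
  have h1 := (volume : Measure (Space d)).measurePreserving_homeomorphUnitSphereProd
  rw [finrank_euclideanSpace_fin] at h1
  have h2 : MeasurePreserving
      (homeomorphUnitSphereProd (Space d)).toMeasurableEquiv.symm _ _ :=
    MeasurePreserving.symm _ h1
  have h3 : MeasurePreserving (Subtype.val : ({0}ᶜ : Set (Space d)) → Space d)
      ((volume : Measure (Space d)).comap Subtype.val) volume := by
    refine ⟨measurable_subtype_coe, ?_⟩
    rw [map_comap_subtype_coe (measurableSet_singleton _).compl, restrict_compl_singleton]
  have h4 : MeasurePreserving (Prod.map (id : Sphere d → Sphere d) (Subtype.val : Set.Ioi (0:ℝ) → ℝ))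
      ((surface d).prod (Measure.volumeIoiPow (d - 1))) ((surface d).prod (radial d)) :=
    (MeasurePreserving.id _).prod ⟨measurable_subtype_coe, map_val_volumeIoiPow _⟩
  refine ⟨by fun_prop, ?_⟩
  rw [← h4.map_eq, Measure.map_map (by fun_prop) h4.measurable]
  exact (h3.comp h2).map_eq

lemma lintegral_polar (hd : 1 ≤ d) {f : Space d → ℝ≥0∞} (hf : Measurable f) :
    ∫⁻ x, f x = ∫⁻ v, (∫⁻ r in Set.Ioi 0, ENNReal.ofReal (r ^ (d - 1)) * f (r • (v : Space d)))
      ∂surface d := by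
  have hm := (measurePreserving_polar hd).measurable
  rw [← (measurePreserving_polar hd).lintegral_comp hf, lintegral_prod _ (by fun_prop)]
  refine lintegral_congr fun v => ?_
  rw [radial, lintegral_withDensity_eq_lintegral_mul _ (by fun_prop) (by fun_prop)]
  rfl

lemma lintegral_pi_polar (hd : 1 ≤ d) {k : ℕ} {F : (Fin k → Space d) → ℝ≥0∞} (hF : Measurable F) :
    ∫⁻ x, F x = ∫⁻ v, (∫⁻ r in Set.univ.pi fun _ : Fin k => Set.Ioi (0 : ℝ),
      (∏ i, ENNReal.ofReal (r i ^ (d - 1))) * F (fun i => r i • (v i : Space d)))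
      ∂Measure.pi fun _ => surface d := by
  have h1 := measurePreserving_pi (fun _ : Fin k => (surface d).prod (radial d))
    (fun _ => volume) fun _ => measurePreserving_polar hd
  have h2 := MeasurePreserving.symm _ (measurePreserving_arrowProdEquivProdArrow (Sphere d) ℝ (Fin k)
    (fun _ => surface d) (fun _ => radial d))
  have h3 : MeasurePreserving (fun (p : (Fin k → Sphere d) × (Fin k → ℝ)) i =>
      p.2 i • (p.1 i : Space d)) _ _ := h1.comp h2
  have hm : Measurable fun p : (Fin k → Sphere d) × (Fin k → ℝ) =>
      F fun i => p.2 i • (p.1 i : Space d) := hF.comp h3.measurable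
  rw [volume_pi, ← h3.lintegral_comp hF, lintegral_prod _ hm.aemeasurable]
  refine lintegral_congr fun v => ?_
  have hr : SigmaFinite ((volume.restrict (Set.Ioi (0 : ℝ))).withDensity
      fun r => ENNReal.ofReal (r ^ (d - 1))) := inferInstanceAs (SigmaFinite (radial d))
  simp only [radial]
  rw [pi_withDensity _ (by fun_prop), ← Measure.restrict_pi_pi,
    lintegral_withDensity_eq_lintegral_mul _ (by fun_prop)]
  · rfl
  · exact hm.comp measurable_prodMk_left

end Polar
-- The angle-doubling map and its Jacobian
section HalfAngle

variable {d : ℕ}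

/-- The identity `det (1 + A * B) = det (1 + B * A)` reduces a rank-two perturbation to a `2 × 2`
determinant. -/
lemma det_smul_id_add_rank_two {α : ℝ} (hα : α ≠ 0) (p z q y : Space d) :
    (α • ContinuousLinearMap.id ℝ (Space d) + (innerSL ℝ p).smulRight z +
      (innerSL ℝ q).smulRight y).det =
      α ^ d * ((1 + ⟪p, z⟫ / α) * (1 + ⟪q, y⟫ / α) - ⟪p, y⟫ * ⟪q, z⟫ / α ^ 2) := by
  let b := (EuclideanSpace.basisFun (Fin d) ℝ).toBasis
  let A : Matrix (Fin d) (Fin 2) ℝ := Matrix.of fun i => ![z i, y i]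
  let B : Matrix (Fin 2) (Fin d) ℝ := Matrix.of ![fun j => p j / α, fun j => q j / α]
  rw [ContinuousLinearMap.det, ← LinearMap.det_toMatrix b]
  have h1 : LinearMap.toMatrix b b ((α • ContinuousLinearMap.id ℝ (Space d) +
      (innerSL ℝ p).smulRight z + (innerSL ℝ q).smulRight y : Space d →L[ℝ] Space d) :
      Space d →ₗ[ℝ] Space d) = α • (1 + A * B) := by
    ext i j
    rw [LinearMap.toMatrix_apply]
    simp [b, A, B, Matrix.mul_apply, Fin.sum_univ_two, Matrix.one_apply,
      PiLp.single_apply, EuclideanSpace.inner_single_right]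
    field_simp
    split_ifs <;> ring
  rw [h1, Matrix.det_smul, Fintype.card_fin, Matrix.det_one_add_mul_comm, Matrix.det_fin_two]
  have hin : ∀ u v : Space d, ∑ i, u i / α * v i = ⟪u, v⟫ / α := by
    intro u v
    rw [PiLp.inner_apply, Finset.sum_div]
    refine Finset.sum_congr rfl fun i _ => ?_
    simp
    ring
  simp only [A, B, Matrix.add_apply, Matrix.mul_apply, Matrix.of_apply, Matrix.cons_val_zero,
    Matrix.cons_val_one, hin, Matrix.one_fin_two, Matrix.cons_val']
  simp
  left
  field_simp

/-- The map doubling the angle with the unit vector `e`, on the half-space of `e`. -/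
noncomputable def doubling (e z : Space d) : Space d := (2 * ⟪e, z⟫ / ‖z‖) • z - ‖z‖ • e

/-- The derivative of `doubling e` at a nonzero point `z`. -/
noncomputable def doublingDeriv (e z : Space d) : Space d →L[ℝ] Space d :=
  (2 * ⟪e, z⟫ / ‖z‖) • ContinuousLinearMap.id ℝ (Space d) +
    (innerSL ℝ ((2 / ‖z‖) • e - (2 * ⟪e, z⟫ / ‖z‖ ^ 3) • z)).smulRight z +
    (innerSL ℝ (‖z‖⁻¹ • z)).smulRight (-e)

lemma hasFDerivAt_norm_of_ne {z : Space d} (hz : z ≠ 0) :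
    HasFDerivAt (fun z : Space d => ‖z‖) (innerSL ℝ (‖z‖⁻¹ • z)) z := by
  have h0 : ‖z‖ ≠ 0 := norm_ne_zero_iff.2 hz
  have h := ((hasStrictFDerivAt_norm_sq z).hasFDerivAt).sqrt (pow_ne_zero 2 h0)
  simp only [Real.sqrt_sq (norm_nonneg _)] at h
  convert! h using 1
  ext v
  simp
  field_simp

lemma hasFDerivAt_doubling (e : Space d) {z : Space d} (hz : z ≠ 0) :
    HasFDerivAt (doubling e) (doublingDeriv e z) z := by
  have h0 : ‖z‖ ≠ 0 := norm_ne_zero_iff.2 hz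
  have hn := hasFDerivAt_norm_of_ne hz
  have hi : HasFDerivAt (fun z : Space d => 2 * ⟪e, z⟫) ((2 : ℝ) • innerSL ℝ e) z :=
    ((innerSL ℝ e).hasFDerivAt).const_mul 2
  have hdiv := hi.mul ((hasDerivAt_inv h0).comp_hasFDerivAt z hn)
  have h := (hdiv.smul (hasFDerivAt_id z)).sub (hn.smul_const e)
  convert! h using 1
  ext v
  simp [doublingDeriv]
  field_simp
  ring

/-- With `a` the cosine of the angle to `e`, this is `2 ^ (d - 1) * a ^ (d - 2)`; the quotient form
also covers `d = 1`. -/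
lemma det_doublingDeriv {e z : Space d} (he : ‖e‖ = 1) (hz : 0 < ⟪e, z⟫) :
    (doublingDeriv e z).det = (2 * (⟪e, z⟫ / ‖z‖)) ^ d / (2 * (⟪e, z⟫ / ‖z‖) ^ 2) := by
  have hz0 : z ≠ 0 := by rintro rfl; simp at hz
  have h0 : ‖z‖ ≠ 0 := norm_ne_zero_iff.2 hz0
  have hα : 2 * ⟪e, z⟫ / ‖z‖ ≠ 0 := by positivity
  rw [doublingDeriv, det_smul_id_add_rank_two hα]
  simp only [inner_sub_left, real_inner_smul_left, inner_neg_right,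
    real_inner_self_eq_norm_sq, he, real_inner_comm e z]
  rw [mul_div_assoc]
  generalize (2 * (⟪e, z⟫ / ‖z‖)) ^ d = X
  have ha := hz.ne'
  generalize ⟪e, z⟫ = a at *
  field_simp
  ring

end HalfAngle
-- Angle doubling as a change of variables on the sphere
section SphereMap

variable {d : ℕ}

lemma norm_doubling {e : Space d} (he : ‖e‖ = 1) (z : Space d) : ‖doubling e z‖ = ‖z‖ := by
  rw [← sq_eq_sq₀ (norm_nonneg _) (norm_nonneg _), doubling, norm_sub_sq_real, norm_smul,
    norm_smul, he, real_inner_smul_left, real_inner_smul_right, real_inner_comm e z, mul_pow]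
  rcases eq_or_ne z 0 with rfl | hz
  · simp
  have h0 : ‖z‖ ≠ 0 := norm_ne_zero_iff.2 hz
  simp only [Real.norm_eq_abs, sq_abs, abs_norm]
  field_simp
  ring

lemma doubling_smul (e z : Space d) {r : ℝ} (hr : 0 < r) :
    doubling e (r • z) = r • doubling e z := by
  rcases eq_or_ne z 0 with rfl | hz
  · simp [doubling]
  have h0 : ‖z‖ ≠ 0 := norm_ne_zero_iff.2 hz
  rw [doubling, doubling, norm_smul, Real.norm_of_nonneg hr.le, real_inner_smul_right, smul_sub,
    smul_smul, smul_smul, smul_smul]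
  congr 2
  field_simp

/-- The map doubling the angle with `e`, on the unit sphere. -/
noncomputable def doublingSphere (e v : Sphere d) : Sphere d :=
  ⟨doubling e v, by
    rw [mem_sphere_zero_iff_norm, norm_doubling (norm_eq_of_mem_sphere e), norm_eq_of_mem_sphere]⟩

/-- The Jacobian of `doublingSphere e` on the hemisphere of `e`, extended by zero. -/
noncomputable def doublingWeight (e v : Sphere d) : ℝ≥0∞ :=
  if 0 < ⟪(e : Space d), (v : Space d)⟫ then
    ENNReal.ofReal ((2 * ⟪(e : Space d), (v : Space d)⟫) ^ d /
      (2 * ⟪(e : Space d), (v : Space d)⟫ ^ 2)) else 0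

/-- The direction of a vector, with the value `e` at the origin. -/
noncomputable def direction (e : Sphere d) (z : Space d) : Sphere d :=
  open Classical in if h : z = 0 then e else ⟨‖z‖⁻¹ • z, by simp [norm_smul, h]⟩

lemma coe_direction (e : Sphere d) {z : Space d} (hz : z ≠ 0) :
    (direction e z : Space d) = ‖z‖⁻¹ • z := by
  rw [direction, dif_neg hz]

lemma direction_smul (e v : Sphere d) {r : ℝ} (hr : 0 < r) : direction e (r • (v : Space d)) = v := by
  have hv : (v : Space d) ≠ 0 := ne_zero_of_mem_unit_sphere v
  ext1
  rw [coe_direction e (smul_ne_zero hr.ne' hv), norm_smul, norm_eq_of_mem_sphere, mul_one,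
    Real.norm_of_nonneg hr.le, inv_smul_smul₀ hr.ne']

lemma measurable_direction (e : Sphere d) : Measurable (direction e) := by
  classical
  refine (MeasurableEmbedding.subtype_coe
    Metric.isClosed_sphere.measurableSet).measurable_comp_iff.1 ?_
  have h : Measurable fun z => if z = 0 then (e : Space d) else ‖z‖⁻¹ • z :=
    Measurable.ite (measurableSet_singleton 0) measurable_const (by fun_prop)
  convert! h using 2 with z
  by_cases hz : z = 0
  · simp [direction, hz]
  · simp [coe_direction e hz, hz]

lemma measurable_doublingSphere (e : Sphere d) : Measurable (doublingSphere e) := by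
  refine Measurable.subtype_mk ?_
  unfold doubling
  fun_prop

lemma measurable_doublingWeight (e : Sphere d) : Measurable (doublingWeight e) := by
  unfold doublingWeight
  exact Measurable.ite (measurableSet_lt measurable_const (by fun_prop)) (by fun_prop)
    measurable_const

/-- The punctured unit ball. -/
def puncturedBall (d : ℕ) : Set (Space d) := {z | z ≠ 0 ∧ ‖z‖ < 1}

lemma measurableSet_puncturedBall : MeasurableSet (puncturedBall d) :=
  (measurableSet_singleton 0).compl.inter (measurableSet_lt measurable_norm measurable_const)

/-- Transfers sphere integrals to the ball, where the change of variables formula is available. The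
radial factor need only be nonzero and finite to cancel. -/
lemma setLIntegral_direction (hd : 1 ≤ d) (e : Sphere d) {h : Sphere d → ℝ≥0∞}
    (hh : Measurable h) :
    ∫⁻ z in puncturedBall d, h (direction e z) =
      (∫⁻ r in Set.Ioi (0 : ℝ), ENNReal.ofReal (r ^ (d - 1)) * (Set.Iio 1).indicator 1 r) *
        ∫⁻ v, h v ∂surface d := by
  have hm : Measurable fun z => h (direction e z) := hh.comp (measurable_direction e)
  rw [← lintegral_indicator measurableSet_puncturedBall,
    lintegral_polar hd ((hm.indicator measurableSet_puncturedBall)), ← lintegral_const_mul _ hh]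
  refine lintegral_congr fun v => ?_
  have hm2 : Measurable fun r : ℝ => ENNReal.ofReal (r ^ (d - 1)) * (Set.Iio 1).indicator 1 r :=
    (by fun_prop : Measurable fun r : ℝ => ENNReal.ofReal (r ^ (d - 1))).mul
      (measurable_one.indicator measurableSet_Iio)
  rw [← lintegral_mul_const _ hm2]
  refine setLIntegral_congr_fun measurableSet_Ioi fun r hr => ?_
  have hr : 0 < r := hr
  have hv : (v : Space d) ≠ 0 := ne_zero_of_mem_unit_sphere v
  have hmem : r • (v : Space d) ∈ puncturedBall d ↔ r ∈ Set.Iio (1 : ℝ) := by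
    simp [puncturedBall, hr.ne', hv, norm_smul, abs_of_pos hr]
  by_cases h1 : r ∈ Set.Iio (1 : ℝ)
  · rw [Set.indicator_of_mem (hmem.2 h1), Set.indicator_of_mem h1, direction_smul e v hr]
    simp
  · rw [Set.indicator_of_notMem (fun h => h1 (hmem.1 h)), Set.indicator_of_notMem h1]
    simp

lemma measure_direction_preimage (hd : 1 ≤ d) (e : Sphere d) {C : Set (Sphere d)}
    (hC : MeasurableSet C) :
    volume (puncturedBall d ∩ direction e ⁻¹' C) =
      (∫⁻ r in Set.Ioi (0 : ℝ), ENNReal.ofReal (r ^ (d - 1)) * (Set.Iio 1).indicator 1 r) *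
        surface d C := by
  have h := setLIntegral_direction hd e (h := C.indicator 1) (measurable_one.indicator hC)
  rw [lintegral_indicator_one hC] at h
  rw [← h, ← lintegral_indicator_one (measurableSet_puncturedBall.inter (measurable_direction e hC)),
    ← lintegral_indicator measurableSet_puncturedBall]
  refine lintegral_congr fun z => ?_
  rw [← Set.indicator_indicator]
  rfl

lemma direction_doubling (e : Sphere d) {z : Space d} (hz : z ≠ 0) :
    direction e (doubling e z) = doublingSphere e (direction e z) := by
  have hn : 0 < ‖z‖ := norm_pos_iff.2 hz
  have h1 : z = ‖z‖ • (direction e z : Space d) := by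
    rw [coe_direction e hz, smul_inv_smul₀ hn.ne']
  conv_lhs => rw [h1, doubling_smul _ _ hn]
  exact direction_smul e (doublingSphere e (direction e z)) hn

lemma doublingSphere_ne_neg {e v : Sphere d} (hv : 0 < ⟪(e : Space d), (v : Space d)⟫) :
    doublingSphere e v ≠ -e := by
  intro h
  have h := congrArg Subtype.val h
  simp only [doublingSphere, doubling, norm_eq_of_mem_sphere, one_smul, div_one,
    Metric.sphere, coe_neg_sphere] at h
  rw [sub_eq_neg_self] at h
  exact smul_ne_zero (mul_pos two_pos hv).ne' (ne_zero_of_mem_unit_sphere v) h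

/-- The preimage is the normalized bisector `u + e`, which degenerates only at `u = -e`. -/
lemma exists_doublingSphere_eq {e u : Sphere d} (hu : u ≠ -e) :
    ∃ v : Sphere d, 0 < ⟪(e : Space d), (v : Space d)⟫ ∧ doublingSphere e v = u := by
  have hs : (u : Space d) + e ≠ 0 := fun h => hu (by
    ext1
    rw [coe_neg_sphere]
    exact eq_neg_of_add_eq_zero_left h)
  have hsn : 0 < ‖(u : Space d) + e‖ := norm_pos_iff.2 hs
  have hsq : ‖(u : Space d) + e‖ ^ 2 = 2 * ⟪(e : Space d), (u : Space d) + e⟫ := by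
    rw [norm_add_sq_real, inner_add_right, real_inner_self_eq_norm_sq, norm_eq_of_mem_sphere,
      norm_eq_of_mem_sphere, real_inner_comm]
    ring
  refine ⟨⟨‖(u : Space d) + e‖⁻¹ • ((u : Space d) + e), by
    rw [mem_sphere_zero_iff_norm, norm_smul, norm_inv, norm_norm, inv_mul_cancel₀ hsn.ne']⟩, ?_, ?_⟩
  · rw [real_inner_smul_right]
    have : 0 < ‖(u : Space d) + e‖ ^ 2 := by positivity
    have h2 : 0 < ⟪(e : Space d), (u : Space d) + e⟫ := by linarith
    positivity
  · ext1
    have h1 : ‖‖(u : Space d) + e‖⁻¹ • ((u : Space d) + e)‖ = 1 := by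
      rw [norm_smul, norm_inv, norm_norm, inv_mul_cancel₀ hsn.ne']
    simp only [doublingSphere, doubling, h1, real_inner_smul_right, smul_smul, one_smul, div_one]
    have h2 : 2 * (‖(u : Space d) + e‖⁻¹ * ⟪(e : Space d), (u : Space d) + e⟫) *
        ‖(u : Space d) + e‖⁻¹ = 1 := by
      field_simp
      linarith
    rw [h2, one_smul, add_sub_cancel_right]

lemma doublingSphere_injOn (e : Sphere d) :
    Set.InjOn (doublingSphere e) {v | 0 < ⟪(e : Space d), (v : Space d)⟫} := by
  intro v hv w hw h
  have h := congrArg Subtype.val h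
  simp only [doublingSphere, doubling, norm_eq_of_mem_sphere, one_smul, div_one, sub_left_inj] at h
  have hv : 0 < 2 * ⟪(e : Space d), (v : Space d)⟫ := mul_pos two_pos hv
  have hw : 0 < 2 * ⟪(e : Space d), (w : Space d)⟫ := mul_pos two_pos hw
  have h1 := congrArg norm h
  rw [norm_smul, norm_smul, norm_eq_of_mem_sphere, norm_eq_of_mem_sphere, Real.norm_of_nonneg hv.le,
    Real.norm_of_nonneg hw.le, mul_one, mul_one] at h1
  rw [h1] at h
  exact Subtype.ext (smul_right_injective _ hw.ne' h)

lemma lintegral_radial_unit_ne (hd : 1 ≤ d) :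
    (∫⁻ r in Set.Ioi (0 : ℝ), ENNReal.ofReal (r ^ (d - 1)) * (Set.Iio 1).indicator 1 r) ≠ 0 ∧
    (∫⁻ r in Set.Ioi (0 : ℝ), ENNReal.ofReal (r ^ (d - 1)) * (Set.Iio 1).indicator 1 r) ≠ ∞ := by
  have : Nonempty (Fin d) := ⟨⟨0, hd⟩⟩
  obtain ⟨e⟩ : Nonempty (Sphere d) := (NormedSpace.sphere_nonempty.2 zero_le_one).to_subtype
  have h := measure_direction_preimage hd e .univ
  have h1 : puncturedBall d = Metric.ball 0 1 \ {0} := by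
    ext z
    simp [puncturedBall, and_comm]
  rw [Set.preimage_univ, Set.inter_univ, h1, measure_sdiff_null (measure_singleton _)] at h
  constructor
  · intro h0
    rw [h0, zero_mul] at h
    exact (Metric.measure_ball_pos volume (0 : Space d) one_pos).ne' h
  · intro h0
    rw [h0, ENNReal.top_mul (Measure.measure_univ_ne_zero.2 (Measure.toSphere_ne_zero _))] at h
    exact measure_ball_lt_top.ne h

/-- `doubling` preserves norms and is positively homogeneous, so its Jacobian on the punctured ball
depends only on the direction and descends to the sphere. The missed point `-e` must be removed
explicitly, since for `d = 1` it has positive mass. -/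
theorem map_doublingSphere (hd : 1 ≤ d) (e : Sphere d) :
    ((surface d).withDensity (doublingWeight e)).map (doublingSphere e) =
      (surface d).restrict {-e}ᶜ := by
  ext B hB
  have hτ := measurable_doublingSphere e
  have hw := measurable_doublingWeight e
  have hn : (1 : ℝ) = ‖(e : Space d)‖ := (norm_eq_of_mem_sphere e).symm
  rw [Measure.map_apply hτ hB, withDensity_apply _ (hτ hB), Measure.restrict_apply hB]
  obtain ⟨hκ0, hκt⟩ := lintegral_radial_unit_ne hd
  -- Multiplying both sides by the radial constant turns them into integrals over the punctured
  -- ball.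
  rw [← ENNReal.mul_right_inj hκ0 hκt, ← measure_direction_preimage hd e
    (hB.inter (measurableSet_singleton _).compl), ← lintegral_indicator (hτ hB),
    ← setLIntegral_direction hd e (hw.indicator (hτ hB))]
  let C : Set (Sphere d) := doublingSphere e ⁻¹' B ∩ {v | 0 < ⟪(e : Space d), (v : Space d)⟫}
  have hC : MeasurableSet C :=
    (hτ hB).inter (measurableSet_lt measurable_const (by fun_prop))
  let D := puncturedBall d ∩ direction e ⁻¹' C
  have hD : MeasurableSet D := measurableSet_puncturedBall.inter (measurable_direction e hC)
  have hpos : ∀ z ∈ D, 0 < ⟪(e : Space d), z⟫ / ‖z‖ := by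
    rintro z ⟨⟨hz, -⟩, -, hz2⟩
    simp only [Set.mem_ofPred_eq, coe_direction e hz, real_inner_smul_right] at hz2
    rwa [div_eq_inv_mul]
  have himg : doubling (e : Space d) '' D = puncturedBall d ∩ direction e ⁻¹' (B ∩ {-e}ᶜ) := by
    ext y
    constructor
    · rintro ⟨z, ⟨⟨hz, hz1⟩, hzB, hz2⟩, rfl⟩
      have hny := norm_doubling hn.symm z
      refine ⟨⟨?_, hny.trans_lt hz1⟩, ?_⟩
      · rw [← norm_ne_zero_iff, hny]
        exact norm_ne_zero_iff.2 hz
      · rw [Set.mem_preimage, direction_doubling e hz]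
        exact ⟨hzB, doublingSphere_ne_neg hz2⟩
    · rintro ⟨⟨hy, hy1⟩, hyB, hye⟩
      have hyn : 0 < ‖y‖ := norm_pos_iff.2 hy
      obtain ⟨v, hv, hvu⟩ := exists_doublingSphere_eq hye
      have hv0 : (v : Space d) ≠ 0 := ne_zero_of_mem_unit_sphere v
      refine ⟨‖y‖ • (v : Space d), ⟨⟨smul_ne_zero hyn.ne' hv0, by
        rwa [norm_smul, norm_norm, norm_eq_of_mem_sphere, mul_one]⟩, ?_⟩, ?_⟩
      · rw [Set.mem_preimage, direction_smul e v hyn]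
        exact ⟨by rwa [Set.mem_preimage, hvu], hv⟩
      · rw [doubling_smul _ _ hyn, show doubling (e : Space d) v = direction e y from
          congrArg Subtype.val hvu, coe_direction e hy, smul_inv_smul₀ hyn.ne']
  have hinj : Set.InjOn (doubling (e : Space d)) D := by
    rintro z ⟨⟨hz, -⟩, -, hz2⟩ w ⟨⟨hw, -⟩, -, hw2⟩ h
    have h1 : ‖z‖ = ‖w‖ := by
      rw [← norm_doubling hn.symm z, h, norm_doubling hn.symm]
    have h2 : direction e z = direction e w := doublingSphere_injOn e hz2 hw2 (by
      rw [← direction_doubling e hz, h, direction_doubling e hw])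
    have h3 := congrArg Subtype.val h2
    rw [coe_direction e hz, coe_direction e hw, h1] at h3
    exact smul_right_injective _ (inv_ne_zero (norm_ne_zero_iff.2 hw)) h3
  have key := lintegral_abs_det_fderiv_eq_addHaar_image volume hD
    (f := doubling (e : Space d)) (f' := doublingDeriv (e : Space d))
    (fun z hz => (hasFDerivAt_doubling _ hz.1.1).hasFDerivWithinAt) hinj
  rw [← himg, ← key, ← lintegral_indicator hD, ← lintegral_indicator measurableSet_puncturedBall]
  refine lintegral_congr fun z => ?_
  by_cases hzP : z ∈ puncturedBall d
  · rw [Set.indicator_of_mem hzP]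
    have ha : ⟪(e : Space d), (direction e z : Space d)⟫ = ⟪(e : Space d), z⟫ / ‖z‖ := by
      rw [coe_direction e hzP.1, real_inner_smul_right, div_eq_inv_mul]
    by_cases hzD : z ∈ D
    · have hp := hpos z hzD
      have hzn : 0 < ‖z‖ := norm_pos_iff.2 hzP.1
      rw [Set.indicator_of_mem hzD, Set.indicator_of_mem hzD.2.1, doublingWeight,
        if_pos (show 0 < ⟪(e : Space d), (direction e z : Space d)⟫ from hzD.2.2), ha, det_doublingDeriv hn.symm ((div_pos_iff_of_pos_right hzn).1 hp),
        abs_of_nonneg (by positivity)]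
    · rw [Set.indicator_of_notMem hzD]
      by_cases hB' : direction e z ∈ doublingSphere e ⁻¹' B
      · rw [Set.indicator_of_mem hB', doublingWeight, if_neg]
        exact fun h => hzD ⟨hzP, hB', h⟩
      · rw [Set.indicator_of_notMem hB']
  · rw [Set.indicator_of_notMem hzP, Set.indicator_of_notMem fun h => hzP h.1]

lemma lintegral_pi_doublingSphere (hd : 1 ≤ d) (e : Sphere d) {k : ℕ}
    {G : (Fin k → Sphere d) → ℝ≥0∞} (hG : Measurable G) (h0 : ∀ u i, u i = -e → G u = 0) :
    ∫⁻ u, G u ∂Measure.pi (fun _ => surface d) =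
      ∫⁻ v, (∏ i, doublingWeight e (v i)) * G (fun i => doublingSphere e (v i))
        ∂Measure.pi fun _ => surface d := by
  have hw := measurable_doublingWeight e
  have : SigmaFinite ((surface d).withDensity (doublingWeight e)) :=
    SigmaFinite.withDensity_of_ne_top (.of_forall fun v => by
      unfold doublingWeight; split_ifs <;> simp)
  have h1 := measurePreserving_pi (fun _ : Fin k => (surface d).withDensity (doublingWeight e))
    (fun _ => (surface d).restrict {-e}ᶜ)
    fun _ => ⟨measurable_doublingSphere e, map_doublingSphere hd e⟩
  have hm : MeasurableSet (Set.univ.pi fun _ : Fin k => ({-e}ᶜ : Set (Sphere d))) :=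
    .univ_pi fun _ => (measurableSet_singleton _).compl
  have h2 := h1.lintegral_comp hG
  have hwm : Measurable fun v : Fin k → Sphere d => ∏ i, doublingWeight e (v i) :=
    Finset.measurable_fun_prod _ fun i _ => hw.comp (measurable_pi_apply i)
  have hGm : Measurable fun v : Fin k → Sphere d => G fun i => doublingSphere e (v i) :=
    hG.comp h1.measurable
  rw [← Measure.restrict_pi_pi, pi_withDensity _ hw, lintegral_withDensity_eq_lintegral_mul _
    hwm hGm, ← lintegral_indicator hm] at h2
  refine Eq.trans (lintegral_congr fun u => ?_) h2.symm
  by_cases hu : u ∈ Set.univ.pi fun _ : Fin k => ({-e}ᶜ : Set (Sphere d))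
  · rw [Set.indicator_of_mem hu]
  · rw [Set.indicator_of_notMem hu]
    simp only [Set.mem_pi, Set.mem_univ, Set.mem_compl_iff, Set.mem_singleton_iff, true_implies,
      not_forall, not_not] at hu
    obtain ⟨i, hi⟩ := hu
    exact h0 u i hi

end SphereMap
-- The Blaschke–Petkantschin formula
section BlaschkePetkantschin

variable {d : ℕ}

/-- The square matrix whose rows are the vectors of the tuple `x`. -/
def rowMatrix (x : Fin d → Space d) : Matrix (Fin d) (Fin d) ℝ := Matrix.of fun i j => x i j

lemma det_rowMatrix_smul (r : Fin d → ℝ) (x : Fin d → Space d) :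
    (rowMatrix fun i => r i • x i).det = (∏ i, r i) * (rowMatrix x).det := by
  rw [← Matrix.det_mul_column]
  rfl

lemma det_rowMatrix_eq_zero {x : Fin d → Space d} {i : Fin d} (h : x i = 0) :
    (rowMatrix x).det = 0 :=
  Matrix.det_eq_zero_of_row_eq_zero i fun j => by simp [rowMatrix, h]

lemma measurable_det_rowMatrix : Measurable fun x : Fin d → Space d => (rowMatrix x).det := by
  simp only [Matrix.det_apply, rowMatrix, Matrix.of_apply]
  fun_prop

lemma linearIndependent_iff_det_ne_zero {x : Fin d → Space d} :
    LinearIndependent ℝ x ↔ (rowMatrix x).det ≠ 0 := by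
  rw [← isUnit_iff_ne_zero, ← Matrix.isUnit_iff_isUnit_det,
    ← Matrix.linearIndependent_rows_iff_isUnit]
  exact ((WithLp.linearEquiv 2 ℝ (Fin d → ℝ)).toLinearMap.linearIndependent_iff
    (LinearEquiv.ker _)).symm

/-- The sphere centered at `c` through the origin meets the ray of a unit vector `v i` at distance
`2 * ⟪c, v i⟫`, so passing from radii to center is linear. -/
lemma lintegral_comp_inner {v : Fin d → Space d} (hv : (rowMatrix v).det ≠ 0)
    {G : (Fin d → ℝ) → ℝ≥0∞} (hG : Measurable G) :
    ∫⁻ r, G r = ENNReal.ofReal (2 ^ d * |(rowMatrix v).det|) *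
      ∫⁻ c : Space d, G fun i => 2 * ⟪c, v i⟫ := by
  let M : Matrix (Fin d) (Fin d) ℝ := (2 : ℝ) • rowMatrix v
  have hdet : M.det = 2 ^ d * (rowMatrix v).det := by simp [M]
  have hM : M.det ≠ 0 := by rw [hdet]; positivity
  have hm : Measurable (Matrix.toLin' M) := by
    exact (LinearMap.continuous_of_finiteDimensional (Matrix.toLin' M)).measurable
  have hGm : Measurable fun r => G (Matrix.toLin' M r) := hG.comp hm
  have h1 := lintegral_map (μ := volume) hG hm
  rw [Real.map_matrix_volume_pi_eq_smul_volume_pi hM, lintegral_smul_measure,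
    ← (PiLp.volume_preserving_ofLp (Fin d)).lintegral_comp hGm] at h1
  have h2 : ∀ c : Space d, Matrix.toLin' M (WithLp.ofLp c) = fun i => 2 * ⟪c, v i⟫ := by
    intro c
    ext i
    simp [M, rowMatrix, Matrix.mulVec, dotProduct, PiLp.inner_apply, Finset.mul_sum, mul_assoc]
  simp only [h2] at h1
  rw [← h1, smul_eq_mul, ← mul_assoc, ← ENNReal.ofReal_mul (by positivity), hdet, abs_inv, abs_mul,
    abs_of_pos (by positivity : (0 : ℝ) < 2 ^ d), mul_inv_cancel₀, ENNReal.ofReal_one, one_mul]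
  positivity

/-- The density `s ^ (d - 1)` of the radial measure. -/
noncomputable def radialDensity (d : ℕ) (s : ℝ) : ℝ≥0∞ :=
  (Set.Ioi 0).indicator (fun s => ENNReal.ofReal (s ^ (d - 1))) s

lemma measurable_radialDensity : Measurable (radialDensity d) :=
  Measurable.indicator (by fun_prop) measurableSet_Ioi

lemma lintegral_directions (hd : 1 ≤ d) {F : (Fin d → Space d) → ℝ≥0∞} (hF : Measurable F)
    (h0 : ∀ x, (rowMatrix x).det = 0 → F x = 0) :
    ∫⁻ x, F x = ∫⁻ v, (∫⁻ c : Space d,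
      ENNReal.ofReal (2 ^ d * |(rowMatrix fun i => (v i : Space d)).det|) *
        ((∏ i, radialDensity d (2 * ⟪c, (v i : Space d)⟫)) *
          F fun i => (2 * ⟪c, (v i : Space d)⟫) • (v i : Space d)))
      ∂Measure.pi fun _ => surface d := by
  rw [lintegral_pi_polar hd hF]
  refine lintegral_congr fun v => ?_
  have hm : Measurable fun r : Fin d → ℝ => (∏ i, radialDensity d (r i)) *
      F fun i => r i • (v i : Space d) := by
    refine (Finset.measurable_fun_prod _ fun i _ =>
      measurable_radialDensity.comp (measurable_pi_apply i)).mul (hF.comp ?_)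
    fun_prop
  have h1 : ∫⁻ r in Set.univ.pi fun _ : Fin d => Set.Ioi (0 : ℝ),
      (∏ i, ENNReal.ofReal (r i ^ (d - 1))) * F (fun i => r i • (v i : Space d)) =
      ∫⁻ r : Fin d → ℝ, (∏ i, radialDensity d (r i)) * F fun i => r i • (v i : Space d) := by
    rw [← lintegral_indicator (.univ_pi fun _ => measurableSet_Ioi)]
    refine lintegral_congr fun r => ?_
    by_cases hr : r ∈ Set.univ.pi fun _ : Fin d => Set.Ioi (0 : ℝ)
    · rw [Set.indicator_of_mem hr]
      congr 1
      exact Finset.prod_congr rfl fun i _ => by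
        rw [radialDensity, Set.indicator_of_mem (hr i trivial)]
    · rw [Set.indicator_of_notMem hr]
      simp only [Set.mem_pi, Set.mem_univ, true_implies, not_forall] at hr
      obtain ⟨i, hi⟩ := hr
      rw [Finset.prod_eq_zero (Finset.mem_univ i), zero_mul]
      rw [radialDensity, Set.indicator_of_notMem hi]
  rw [h1]
  by_cases hv : (rowMatrix fun i => (v i : Space d)).det = 0
  · have h2 : ∀ r : Fin d → ℝ, F (fun i => r i • (v i : Space d)) = 0 := fun r =>
      h0 _ (by rw [det_rowMatrix_smul, hv, mul_zero])
    simp [h2]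
  · rw [lintegral_comp_inner hv hm, lintegral_const_mul' _ _ ENNReal.ofReal_ne_top]

/-- The inscribed angle theorem: `(2 * ⟪c, v⟫) • v = c + ‖c‖ • u`, where `u` is obtained from `v` by
doubling its angle with the axis `c`. -/
lemma lintegral_sphere_directions (hd : 1 ≤ d) {F : (Fin d → Space d) → ℝ≥0∞} (hF : Measurable F)
    {c : Space d} (hc : c ≠ 0) :
    ∫⁻ v, (ENNReal.ofReal (2 ^ d * |(rowMatrix fun i => (v i : Space d)).det|) *
        ((∏ i, radialDensity d (2 * ⟪c, (v i : Space d)⟫)) *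
          F fun i => (2 * ⟪c, (v i : Space d)⟫) • (v i : Space d)))
      ∂Measure.pi (fun _ => surface d) =
    ∫⁻ u, F (fun i => c + ‖c‖ • (u i : Space d)) * ENNReal.ofReal (‖c‖ ^ (d * (d - 1)) *
        |(rowMatrix fun i => (u i : Space d) + ‖c‖⁻¹ • c).det|)
      ∂Measure.pi fun _ => surface d := by
  have hcn : 0 < ‖c‖ := norm_pos_iff.2 hc
  let e : Sphere d := ⟨‖c‖⁻¹ • c, by simp [norm_smul, hc]⟩
  have he : c = ‖c‖ • (e : Space d) := by simp [e, smul_inv_smul₀ hcn.ne']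
  have hGm : Measurable fun u : Fin d → Sphere d =>
      F (fun i => c + ‖c‖ • (u i : Space d)) * ENNReal.ofReal (‖c‖ ^ (d * (d - 1)) *
        |(rowMatrix fun i => (u i : Space d) + ‖c‖⁻¹ • c).det|) := by
    have h1 : Measurable fun u : Fin d → Sphere d => fun i => c + ‖c‖ • (u i : Space d) := by
      fun_prop
    have h2 : Measurable fun u : Fin d → Sphere d => fun i => (u i : Space d) + ‖c‖⁻¹ • c := by
      fun_prop
    have h3 := measurable_det_rowMatrix.comp h2
    exact (hF.comp h1).mul (by fun_prop)
  rw [lintegral_pi_doublingSphere hd e hGm]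
  swap
  · intro u i hu
    have : (u i : Space d) + ‖c‖⁻¹ • c = 0 := by rw [hu]; simp [e]
    rw [det_rowMatrix_eq_zero this]
    simp
  refine lintegral_congr fun v => ?_
  have hinner : ∀ i, ⟪c, (v i : Space d)⟫ = ‖c‖ * ⟪(e : Space d), (v i : Space d)⟫ := fun i => by
    conv_lhs => rw [he, real_inner_smul_left]
  have hτ : ∀ i, (doublingSphere e (v i) : Space d) =
      (2 * ⟪(e : Space d), (v i : Space d)⟫) • (v i : Space d) - e := fun i => by
    simp [doublingSphere, doubling, norm_eq_of_mem_sphere]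
  have h1 : ∀ i, c + ‖c‖ • (doublingSphere e (v i) : Space d) =
      (2 * ⟪c, (v i : Space d)⟫) • (v i : Space d) := fun i => by
    rw [hτ, hinner, smul_sub, ← he, smul_smul, add_sub_cancel]
    congr 1
    ring
  have h2 : ∀ i, (doublingSphere e (v i) : Space d) + ‖c‖⁻¹ • c =
      (2 * ⟪(e : Space d), (v i : Space d)⟫) • (v i : Space d) := fun i => by
    rw [hτ]
    exact sub_add_cancel _ _
  simp only [h1, h2, det_rowMatrix_smul]
  suffices h : ENNReal.ofReal (2 ^ d * |(rowMatrix fun i => (v i : Space d)).det|) *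
      ∏ i, radialDensity d (2 * ⟪c, (v i : Space d)⟫) = (∏ i, doublingWeight e (v i)) *
      ENNReal.ofReal (‖c‖ ^ (d * (d - 1)) *
        |(∏ i, 2 * ⟪(e : Space d), (v i : Space d)⟫) * (rowMatrix fun i => (v i : Space d)).det|) by
    rw [← mul_assoc, h]
    ring
  by_cases hpos : ∀ i, 0 < ⟪(e : Space d), (v i : Space d)⟫
  · have hw : ∀ i, doublingWeight e (v i) =
        ENNReal.ofReal ((2 * ⟪(e : Space d), (v i : Space d)⟫) ^ d /
          (2 * ⟪(e : Space d), (v i : Space d)⟫ ^ 2)) := fun i => if_pos (hpos i)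
    have hρ : ∀ i, radialDensity d (2 * ⟪c, (v i : Space d)⟫) =
        ENNReal.ofReal ((2 * (‖c‖ * ⟪(e : Space d), (v i : Space d)⟫)) ^ (d - 1)) := fun i => by
      rw [hinner, radialDensity, Set.indicator_of_mem]
      exact mul_pos two_pos (mul_pos hcn (hpos i))
    simp only [hw, hρ]
    rw [← ENNReal.ofReal_prod_of_nonneg fun i _ => by have := hpos i; positivity,
      ← ENNReal.ofReal_prod_of_nonneg fun i _ => by have := hpos i; positivity,
      ← ENNReal.ofReal_mul (by positivity),
      ← ENNReal.ofReal_mul (Finset.prod_nonneg fun i _ => by have := hpos i; positivity)]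
    congr 1
    rw [abs_mul, Finset.abs_prod]
    -- The factor `2 ^ d` is shared out, one `2` per point, so the identity of densities can be
    -- checked index by index.
    have h3 : ∀ i, (2 * (‖c‖ * ⟪(e : Space d), (v i : Space d)⟫)) ^ (d - 1) * 2 =
        (2 * ⟪(e : Space d), (v i : Space d)⟫) ^ d /
          (2 * ⟪(e : Space d), (v i : Space d)⟫ ^ 2) *
          |2 * ⟪(e : Space d), (v i : Space d)⟫| * ‖c‖ ^ (d - 1) := fun i => by
      have ha := hpos i
      rw [abs_of_pos (by positivity)]
      obtain ⟨m, rfl⟩ : ∃ m, d = m + 1 := ⟨d - 1, by omega⟩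
      rw [Nat.add_sub_cancel]
      field_simp
      ring
    have h4 := Finset.prod_congr (rfl : (Finset.univ : Finset (Fin d)) = _) fun i _ => h3 i
    simp only [Finset.prod_mul_distrib, Finset.prod_const, Finset.card_univ,
      Fintype.card_fin] at h4
    rw [pow_mul', ← pow_mul]
    rw [← pow_mul] at h4
    linear_combination |(rowMatrix fun i => (v i : Space d)).det| * h4
  · simp only [not_forall] at hpos
    obtain ⟨i, hi⟩ := hpos
    have hw : ∏ i, doublingWeight e (v i) = 0 :=
      Finset.prod_eq_zero (Finset.mem_univ i) (if_neg hi)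
    have hρ : ∏ i, radialDensity d (2 * ⟪c, (v i : Space d)⟫) = 0 := by
      refine Finset.prod_eq_zero (Finset.mem_univ i) ?_
      rw [hinner, radialDensity, Set.indicator_of_notMem]
      intro h
      have h : 0 < 2 * (‖c‖ * ⟪(e : Space d), (v i : Space d)⟫) := h
      exact hi (pos_of_mul_pos_right (pos_of_mul_pos_right h zero_le_two) hcn.le)
    rw [hw, hρ, zero_mul, mul_zero]

/-- The spherical Blaschke–Petkantschin formula for spheres through the origin. -/
theorem lintegral_blaschke_petkantschin (hd : 1 ≤ d) {F : (Fin d → Space d) → ℝ≥0∞}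
    (hF : Measurable F) (h0 : ∀ x, (rowMatrix x).det = 0 → F x = 0) :
    ∫⁻ x, F x = ∫⁻ c : Space d, ∫⁻ u,
      F (fun i => c + ‖c‖ • (u i : Space d)) * ENNReal.ofReal (‖c‖ ^ (d * (d - 1)) *
        |(rowMatrix fun i => (u i : Space d) + ‖c‖⁻¹ • c).det|)
      ∂Measure.pi fun _ => surface d := by
  have : Nonempty (Fin d) := ⟨⟨0, hd⟩⟩
  rw [lintegral_directions hd hF h0, lintegral_lintegral_swap]
  · refine lintegral_congr_ae ?_
    filter_upwards [compl_mem_ae_iff.2 (measure_singleton (0 : Space d))] with c hc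
    exact lintegral_sphere_directions hd hF hc
  · have h1 : Measurable fun p : (Fin d → Sphere d) × Space d => fun i => (p.1 i : Space d) := by
      fun_prop
    have h2 := measurable_det_rowMatrix.comp h1
    have h3 : ∀ i, Measurable fun p : (Fin d → Sphere d) × Space d =>
        2 * ⟪p.2, (p.1 i : Space d)⟫ := fun i => by fun_prop
    have h4 : Measurable fun p : (Fin d → Sphere d) × Space d => fun i =>
        (2 * ⟪p.2, (p.1 i : Space d)⟫) • (p.1 i : Space d) := by fun_prop
    have h5 : Measurable fun p : (Fin d → Sphere d) × Space d =>
        ENNReal.ofReal (2 ^ d * |(rowMatrix fun i => (p.1 i : Space d)).det|) := by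
      exact ENNReal.measurable_ofReal.comp ((measurable_const.mul h2.abs))
    exact (h5.mul ((Finset.measurable_fun_prod _ fun i _ =>
      measurable_radialDensity.comp (h3 i)).mul (hF.comp h4))).aemeasurable

end BlaschkePetkantschin
-- The projection condition as a cone condition
section PointyCondition

variable {d : ℕ}

lemma mem_convexHull_range_iff {E : Type*} [AddCommGroup E] [Module ℝ E] {n : ℕ} {p : Fin n → E}
    {y : E} : y ∈ convexHull ℝ (Set.range p) ↔
      ∃ w : Fin n → ℝ, (∀ i, 0 ≤ w i) ∧ ∑ i, w i = 1 ∧ ∑ i, w i • p i = y := by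
  have h : Set.range p = Fintype.linearCombination ℝ p ''
      Set.range fun i j : Fin n => if i = j then (1 : ℝ) else 0 := by
    rw [← Set.range_comp]
    congr 1
    ext i
    simp [Fintype.linearCombination_apply]
  rw [h, ← LinearMap.image_convexHull, convexHull_basis_eq_stdSimplex]
  simp [stdSimplex, Fintype.linearCombination_apply, and_assoc]

/-- For each `i` some `-ε • p i` is still in the hull, which gives a nonnegative relation with
positive weight at `i`; summing these relations makes all weights positive. -/
lemma exists_pos_of_zero_mem_intrinsicInterior {n : ℕ} {p : Fin n → Space d}
    (h : (0 : Space d) ∈ intrinsicInterior ℝ (convexHull ℝ (Set.range p))) :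
    ∃ w : Fin n → ℝ, (∀ i, 0 < w i) ∧ ∑ i, w i • p i = 0 := by
  obtain ⟨y, hy, hy0⟩ := mem_intrinsicInterior.1 h
  have h1 : ∀ i, ∃ w : Fin n → ℝ, (∀ j, 0 ≤ w j) ∧ 0 < w i ∧ ∑ j, w j • p j = 0 := by
    intro i
    have h0 : (0 : Space d) ∈ affineSpan ℝ (convexHull ℝ (Set.range p)) := hy0 ▸ y.2
    have hi : p i ∈ affineSpan ℝ (convexHull ℝ (Set.range p)) :=
      subset_affineSpan _ _ (subset_convexHull _ _ ⟨i, rfl⟩)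
    let f : ℝ → affineSpan ℝ (convexHull ℝ (Set.range p)) := fun ε =>
      ⟨AffineMap.lineMap 0 (p i) (-ε), AffineMap.lineMap_mem _ h0 hi⟩
    have hf : Continuous f := by
      refine Continuous.subtype_mk ?_ _
      exact AffineMap.lineMap_continuous.comp continuous_neg
    have hf0 : f 0 = y := by
      ext1
      simp [f, hy0]
    have hev : ∀ᶠ ε in nhds (0 : ℝ), f ε ∈ interior
        ((↑) ⁻¹' (convexHull ℝ (Set.range p)) : Set (affineSpan ℝ (convexHull ℝ (Set.range p)))) :=
      hf.continuousAt.eventually (isOpen_interior.mem_nhds (hf0 ▸ hy))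
    obtain ⟨ε, hε, hpos⟩ := ((hev.filter_mono nhdsWithin_le_nhds).and
      (self_mem_nhdsWithin (a := (0 : ℝ)) (s := Set.Ioi 0))).exists
    have hpos : 0 < ε := hpos
    have hε' : (f ε : Space d) ∈ convexHull ℝ (Set.range p) :=
      Set.mem_preimage.1 (interior_subset hε)
    obtain ⟨w, hw, -, hwp⟩ := mem_convexHull_range_iff.1 hε'
    refine ⟨fun j => w j + if j = i then ε else 0, fun j => ?_, ?_, ?_⟩
    · have := hw j
      change 0 ≤ w j + if j = i then ε else 0
      split_ifs <;> linarith
    · have := hw i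
      simp only [if_true]
      linarith
    · simp only [add_smul, Finset.sum_add_distrib, hwp, ite_smul, zero_smul,
        Finset.sum_ite_eq', Finset.mem_univ, if_true, f, AffineMap.lineMap_apply_module]
      simp
  choose w hw hwp hw0 using h1
  refine ⟨fun j => ∑ i, w i j, fun j => ?_, ?_⟩
  · exact Finset.sum_pos' (fun i _ => hw i j) ⟨j, Finset.mem_univ _, hwp j⟩
  · simp only [Finset.sum_smul]
    rw [Finset.sum_comm]
    simp [hw0]

/-- The combination map onto the span of `p` is open. It sends the open set of positive weights with
sum below `1` into the hull, and the rescaled relation is one of these weights with image `0`. -/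
lemma zero_mem_intrinsicInterior_of_pos {n : ℕ} (hn : 1 ≤ n) {p : Fin n → Space d}
    {w : Fin n → ℝ} (hw : ∀ i, 0 < w i) (h : ∑ i, w i • p i = 0) :
    (0 : Space d) ∈ intrinsicInterior ℝ (convexHull ℝ (Set.range p)) := by
  have : Nonempty (Fin n) := ⟨⟨0, hn⟩⟩
  have hW : 0 < ∑ i, w i := Finset.sum_pos (fun i _ => hw i) Finset.univ_nonempty
  have h0 : (0 : Space d) ∈ convexHull ℝ (Set.range p) := by
    refine mem_convexHull_range_iff.2 ⟨fun i => w i / ∑ i, w i, fun i =>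
      div_nonneg (hw i).le hW.le, ?_, ?_⟩
    · rw [← Finset.sum_div, div_self hW.ne']
    · simp only [div_eq_inv_mul, mul_smul]
      rw [← Finset.smul_sum, h, smul_zero]
  let L : (Fin n → ℝ) →ₗ[ℝ] Submodule.span ℝ (Set.range p) :=
    (Fintype.linearCombination ℝ p).codRestrict _ fun c => by
      rw [← Fintype.range_linearCombination]
      exact ⟨c, rfl⟩
  have hL : Function.Surjective L := by
    rintro ⟨y, hy⟩
    rw [← Fintype.range_linearCombination] at hy
    obtain ⟨c, hc⟩ := hy
    exact ⟨c, Subtype.ext hc⟩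
  let U : Set (Fin n → ℝ) := {ν | (∀ i, 0 < ν i) ∧ ∑ i, ν i < 1}
  have hU : IsOpen U := by
    have h1 : IsOpen {ν : Fin n → ℝ | ∀ i, 0 < ν i} := by
      simp only [Set.ofPred_forall]
      exact isOpen_iInter_of_finite fun i => isOpen_lt continuous_const (continuous_apply i)
    have h2 : Continuous fun ν : Fin n → ℝ => ∑ i, ν i := by fun_prop
    exact h1.inter (isOpen_lt h2 continuous_const)
  have hLU : IsOpen (L '' U) := L.isOpenMap_of_finiteDimensional hL U hU
  have hsub : ∀ y ∈ affineSpan ℝ (convexHull ℝ (Set.range p)),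
      y ∈ Submodule.span ℝ (Set.range p) := by
    intro y hy
    have h1 : affineSpan ℝ (convexHull ℝ (Set.range p)) ≤
        (Submodule.span ℝ (Set.range p)).toAffineSubspace := by
      rw [affineSpan_convexHull]
      exact affineSpan_le.2 Submodule.subset_span
    exact h1 hy
  let f : affineSpan ℝ (convexHull ℝ (Set.range p)) → Submodule.span ℝ (Set.range p) :=
    fun y => ⟨y, hsub y y.2⟩
  have hf : Continuous f := by fun_prop
  refine mem_intrinsicInterior.2 ⟨⟨0, subset_affineSpan _ _ h0⟩, ?_, rfl⟩
  refine mem_interior.2 ⟨f ⁻¹' (L '' U), ?_, hLU.preimage hf, ?_⟩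
  · rintro y ⟨ν, ⟨hν, hν1⟩, hy⟩
    have hy : ∑ i, ν i • p i = y := congrArg Subtype.val hy
    have hν0 : 0 < ∑ i, ν i := Finset.sum_pos (fun i _ => hν i) Finset.univ_nonempty
    have hc : (y : Space d) = (∑ i, ν i) • ∑ i, (ν i / ∑ i, ν i) • p i + (1 - ∑ i, ν i) • 0 := by
      rw [← hy, Finset.smul_sum, smul_zero, add_zero]
      refine Finset.sum_congr rfl fun i _ => ?_
      rw [smul_smul, mul_div_cancel₀ _ hν0.ne']
    rw [Set.mem_preimage, hc]
    refine (convex_convexHull ℝ _) (mem_convexHull_range_iff.2 ⟨_, fun i =>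
      div_nonneg (hν i).le hν0.le, ?_, rfl⟩) h0 hν0.le (by linarith) (by ring)
    rw [← Finset.sum_div, div_self hν0.ne']
  · refine ⟨fun i => w i / (2 * ∑ i, w i), ⟨fun i => div_pos (hw i) (by positivity), ?_⟩, ?_⟩
    · rw [← Finset.sum_div, div_lt_one (by positivity)]
      linarith
    · ext1
      change ∑ i, (w i / (2 * ∑ i, w i)) • p i = 0
      simp only [div_eq_inv_mul, mul_smul]
      rw [← Finset.smul_sum, h, smul_zero]

/-- The edge vectors of a simplex at its vertex of index `0`. -/
def edgeVectors (u : Fin (d + 1) → Sphere d) (i : Fin d) : Space d := u i.succ - u 0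

/-- The projection kills `u 0`, so a positive relation between the projections says that `∑ w i •
edgeVectors u i = a • u 0`. Pairing with `u 0` gives `a ≤ 0`, independence excludes `a = 0`, and
rescaling reaches `-u 0`. -/
lemma pointyCondition_iff (hd : 1 ≤ d) {u : Fin (d + 1) → Sphere d}
    (hu : LinearIndependent ℝ (edgeVectors u)) :
    pointyCondition u ↔ IsPointyTuple (edgeVectors u) (-(u 0 : Space d)) := by
  have hn : ∀ i, ‖(u i : Space d)‖ = 1 := fun i => norm_eq_of_mem_sphere _
  have hproj : ∀ w : Fin d → ℝ, ∑ i, w i • (ℝ ∙ (u 0 : Space d))ᗮ.starProjection (u i.succ : Space d)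
      = (ℝ ∙ (u 0 : Space d))ᗮ.starProjection (∑ i, w i • edgeVectors u i) := by
    intro w
    have h0 : (ℝ ∙ (u 0 : Space d))ᗮ.starProjection (u 0 : Space d) = 0 := by
      rw [Submodule.starProjection_apply_eq_zero_iff]
      rw [Submodule.orthogonal_orthogonal]
      exact Submodule.mem_span_singleton_self _
    rw [map_sum]
    refine Finset.sum_congr rfl fun i _ => ?_
    rw [map_smul, edgeVectors, map_sub, h0, sub_zero]
  have hkey : pointyCondition u ↔ ∃ w : Fin d → ℝ, (∀ i, 0 < w i) ∧
      (ℝ ∙ (u 0 : Space d))ᗮ.starProjection (∑ i, w i • edgeVectors u i) = 0 := by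
    simp only [← hproj]
    exact ⟨exists_pos_of_zero_mem_intrinsicInterior, fun ⟨w, hw, h⟩ =>
      zero_mem_intrinsicInterior_of_pos hd hw h⟩
  rw [hkey]
  constructor
  · rintro ⟨w, hw, h⟩
    refine ⟨hu, fun i => ?_, ?_⟩
    · rw [edgeVectors, sub_neg_eq_add, sub_add_cancel, norm_neg, hn, hn]
    rw [Submodule.starProjection_apply_eq_zero_iff, Submodule.orthogonal_orthogonal,
      Submodule.mem_span_singleton] at h
    obtain ⟨a, ha⟩ := h
    have h1 : a = ∑ i, w i * (⟪(u i.succ : Space d), (u 0 : Space d)⟫ - 1) := by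
      have h2 := congrArg (fun z => ⟪z, (u 0 : Space d)⟫) ha
      simp only [real_inner_smul_left, real_inner_self_eq_norm_sq, hn, sum_inner, edgeVectors,
        inner_sub_left, one_pow, mul_one] at h2
      exact h2
    have h2 : a ≤ 0 := by
      rw [h1]
      refine Finset.sum_nonpos fun i _ => mul_nonpos_of_nonneg_of_nonpos (hw i).le ?_
      have := real_inner_le_norm (u i.succ : Space d) (u 0 : Space d)
      rw [hn, hn] at this
      linarith
    have h3 : a ≠ 0 := by
      rintro rfl
      rw [zero_smul] at ha
      exact (hw ⟨0, hd⟩).ne' (Fintype.linearIndependent_iff.1 hu w ha.symm _)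
    have h4 : 0 < -a := by
      rcases h2.lt_or_eq with h | h
      · linarith
      · exact absurd h h3
    refine ⟨fun i => (-a)⁻¹ * w i, fun i => mul_pos (inv_pos.2 h4) (hw i), ?_⟩
    simp only [mul_smul]
    rw [← Finset.smul_sum, ← ha, smul_smul, inv_neg, neg_mul, inv_mul_cancel₀ h3, neg_one_smul]
  · rintro ⟨-, -, w, hw, h⟩
    refine ⟨w, hw, ?_⟩
    rw [h, Submodule.starProjection_apply_eq_zero_iff, Submodule.orthogonal_orthogonal]
    exact neg_mem (Submodule.mem_span_singleton_self _)

end PointyCondition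

/-! ### Measurable formulas for the circumcenter -/

section Circumcenter

variable {d : ℕ}

/-- The center of the sphere through the origin and the points of the tuple `x`. -/
noncomputable def circumcenter (x : Fin d → Space d) : Space d :=
  WithLp.toLp 2 ((rowMatrix x)⁻¹.mulVec fun i => ‖x i‖ ^ 2 / 2)

/-- The coordinates of the circumcenter of `x` in the basis `x`. -/
noncomputable def circumWeights (x : Fin d → Space d) : Fin d → ℝ :=
  (rowMatrix x)⁻¹.vecMul (WithLp.ofLp (circumcenter x))

lemma norm_sub_circumcenter {x : Fin d → Space d} (hx : (rowMatrix x).det ≠ 0) (i : Fin d) :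
    ‖x i - circumcenter x‖ = ‖circumcenter x‖ := by
  rw [norm_sub_eq_norm_iff]
  have h : (rowMatrix x).mulVec ((rowMatrix x)⁻¹.mulVec fun i => ‖x i‖ ^ 2 / 2) =
      fun i => ‖x i‖ ^ 2 / 2 := by
    rw [Matrix.mulVec_mulVec, Matrix.mul_nonsing_inv _ (isUnit_iff_ne_zero.2 hx),
      Matrix.one_mulVec]
  have h1 := congrFun h i
  rw [← h1, PiLp.inner_apply, Matrix.mulVec, dotProduct]
  refine Finset.sum_congr rfl fun j _ => ?_
  simp [circumcenter, rowMatrix, mul_comm]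

lemma sum_smul_eq_vecMul (w : Fin d → ℝ) (x : Fin d → Space d) :
    ∑ i, w i • x i = WithLp.toLp 2 ((rowMatrix x).vecMul w) := by
  ext j
  simp [Matrix.vecMul, dotProduct, rowMatrix]

lemma sum_circumWeights {x : Fin d → Space d} (hx : (rowMatrix x).det ≠ 0) :
    ∑ i, circumWeights x i • x i = circumcenter x := by
  rw [sum_smul_eq_vecMul, circumWeights, Matrix.vecMul_vecMul,
    Matrix.nonsing_inv_mul _ (isUnit_iff_ne_zero.2 hx), Matrix.vecMul_one]

/-- Removes both existential quantifiers in favor of matrix formulas, from which measurability can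
be read off. -/
lemma isPointyTuple_iff {x : Fin d → Space d} {c : Space d} :
    IsPointyTuple x c ↔
      (rowMatrix x).det ≠ 0 ∧ c = circumcenter x ∧ ∀ i, 0 < circumWeights x i := by
  constructor
  · rintro ⟨hli, hxc, w, hw, hwc⟩
    have hdet := linearIndependent_iff_det_ne_zero.1 hli
    have hc : c = circumcenter x := circumcenter_unique hli hxc (norm_sub_circumcenter hdet)
    refine ⟨hdet, hc, fun i => ?_⟩
    have h1 : ∑ i, w i • x i = ∑ i, circumWeights x i • x i := by
      rw [hwc, sum_circumWeights hdet, hc]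
    have h2 := Fintype.linearIndependent_iff.1 hli (fun i => w i - circumWeights x i) (by
      simp only [sub_smul, Finset.sum_sub_distrib, h1, sub_self]) i
    have := hw i
    linarith
  · rintro ⟨hdet, rfl, hw⟩
    exact ⟨linearIndependent_iff_det_ne_zero.2 hdet, norm_sub_circumcenter hdet, _, hw,
      sum_circumWeights hdet⟩

lemma measurable_inv_rowMatrix (i j : Fin d) :
    Measurable fun x : Fin d → Space d => (rowMatrix x)⁻¹ i j := by
  have h1 : Continuous fun x : Fin d → Space d => rowMatrix x := by
    unfold rowMatrix
    fun_prop
  have h2 : Measurable fun x : Fin d → Space d => (rowMatrix x).adjugate i j :=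
    (h1.matrix_adjugate.matrix_elem i j).measurable
  simp only [Matrix.inv_def, Ring.inverse_eq_inv', Matrix.smul_apply, smul_eq_mul]
  exact measurable_det_rowMatrix.inv.mul h2

lemma measurable_circumcenter : Measurable (circumcenter : (Fin d → Space d) → Space d) := by
  refine (WithLp.measurable_toLp 2 _).comp (measurable_pi_iff.2 fun i => ?_)
  simp only [Matrix.mulVec, dotProduct]
  exact Finset.measurable_fun_sum _ fun j _ => (measurable_inv_rowMatrix i j).mul (by fun_prop)

lemma measurable_circumWeights (i : Fin d) :
    Measurable fun x : Fin d → Space d => circumWeights x i := by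
  simp only [circumWeights, Matrix.vecMul, dotProduct]
  refine Finset.measurable_fun_sum _ fun j _ => Measurable.mul ?_ (measurable_inv_rowMatrix j i)
  have h : Measurable fun z : Space d => z j := by fun_prop
  exact h.comp measurable_circumcenter

/-- The linearly independent tuples whose circumcenter is at distance at least `t` from the origin
and lies in the interior of the cone spanned by the tuple. -/
def pointySet (d : ℕ) (t : ℝ) : Set (Fin d → Space d) :=
  {x | IsPointyTuple x (circumcenter x) ∧ t ≤ ‖circumcenter x‖}

lemma measurableSet_pointySet (t : ℝ) : MeasurableSet (pointySet d t) := by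
  have h1 : pointySet d t = ({x | (rowMatrix x).det ≠ 0} ∩ ⋂ i, {x | 0 < circumWeights x i}) ∩
      {x | t ≤ ‖circumcenter x‖} := by
    ext x
    simp [pointySet, isPointyTuple_iff]
  rw [h1]
  refine ((measurable_det_rowMatrix (measurableSet_singleton 0).compl).inter
    (.iInter fun i => measurableSet_lt measurable_const (measurable_circumWeights i))).inter
    (measurableSet_le measurable_const measurable_circumcenter.norm)

end Circumcenter
-- The volume of a simplex as a determinant
section SimplexVolume

variable {d : ℕ}

lemma pi_const_smul {α : Type*} [MeasurableSpace α] {n : ℕ} (μ : Measure α) [SigmaFinite μ]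
    (c : ℝ≥0∞) [SigmaFinite (c • μ)] :
    Measure.pi (fun _ : Fin n => c • μ) = c ^ n • Measure.pi fun _ : Fin n => μ := by
  refine Measure.pi_eq fun s _ => ?_
  simp [Measure.pi_pi, Finset.prod_mul_distrib]

lemma map_abs_volume :
    (volume : Measure ℝ).map (fun x => |x|) = (2 : ℝ≥0∞) • volume.restrict (Set.Ici 0) := by
  ext s hs
  have hm : Measurable fun x : ℝ => |x| := by fun_prop
  rw [Measure.map_apply hm hs, Measure.smul_apply, Measure.restrict_apply hs, smul_eq_mul, two_mul,
    ← measure_inter_add_sdiff _ (measurableSet_Ici (a := (0 : ℝ)))]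
  have h1 : (fun x : ℝ => |x|) ⁻¹' s ∩ Set.Ici 0 = s ∩ Set.Ici 0 := by
    ext x
    simp only [Set.mem_inter_iff, Set.mem_preimage, Set.mem_Ici, and_congr_left_iff]
    intro hx
    rw [abs_of_nonneg hx]
  have h2 : volume ((fun x : ℝ => |x|) ⁻¹' s \ Set.Ici 0) = volume (s ∩ Set.Ici 0) := by
    rw [Set.sdiff_eq, Set.compl_Ici, ← Measure.restrict_apply (hm hs), Measure.restrict_congr_set
      Iio_ae_eq_Iic, Measure.restrict_apply (hm hs)]
    rw [← Measure.measure_preimage_neg volume (s ∩ Set.Ici 0)]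
    congr 1
    ext x
    simp only [Set.mem_inter_iff, Set.mem_preimage, Set.mem_Ici, Set.mem_Iic,
      Left.nonneg_neg_iff, and_congr_left_iff]
    intro hx
    rw [abs_of_nonpos hx]
  rw [h1, h2]

/-- Folding by coordinatewise absolute values shows that the `ℓ¹` unit ball, of volume `2 ^ d / d!`,
is `2 ^ d` times as large. -/
lemma volume_cornerSimplex (hd : 1 ≤ d) :
    volume {y : Fin d → ℝ | (∀ i, 0 ≤ y i) ∧ ∑ i, y i ≤ 1} = ENNReal.ofReal (d ! : ℝ)⁻¹ := by
  have : Nonempty (Fin d) := ⟨⟨0, hd⟩⟩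
  have hS : MeasurableSet {y : Fin d → ℝ | ∑ i, y i ≤ 1} :=
    measurableSet_le (by fun_prop) measurable_const
  have : SigmaFinite ((2 : ℝ≥0∞) • (volume : Measure ℝ).restrict (Set.Ici 0)) := by
    rw [ofNat_smul_eq_nsmul, two_nsmul]
    infer_instance
  have h1 := measurePreserving_pi (fun _ : Fin d => (volume : Measure ℝ))
    (fun _ => (2 : ℝ≥0∞) • volume.restrict (Set.Ici 0))
    (f := fun _ x => |x|) fun _ => ⟨by fun_prop, map_abs_volume⟩
  have h2 := h1.measure_preimage hS.nullMeasurableSet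
  rw [pi_const_smul, Measure.smul_apply, ← Measure.restrict_pi_pi, Measure.restrict_apply hS,
    smul_eq_mul, ← volume_pi] at h2
  have h3 := MeasureTheory.volume_sum_rpow_le (Fin d) (p := 1) le_rfl 1
  have h4 : {x : Fin d → ℝ | (∑ i, |x i| ^ (1 : ℝ)) ^ (1 / 1 : ℝ) ≤ 1} =
      (fun a i => |a i|) ⁻¹' {y : Fin d → ℝ | ∑ i, y i ≤ 1} := by
    ext x
    simp
  have h5 : {y : Fin d → ℝ | (∀ i, 0 ≤ y i) ∧ ∑ i, y i ≤ 1} =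
      {y | ∑ i, y i ≤ 1} ∩ Set.univ.pi fun _ => Set.Ici 0 := by
    ext y
    simp [and_comm, Pi.le_def]
  rw [h4, h2, ← h5] at h3
  simp only [ENNReal.ofReal_one, one_pow, one_mul, div_one, Fintype.card_fin,
    one_add_one_eq_two, Real.Gamma_two, mul_one, Real.Gamma_nat_eq_factorial] at h3
  rw [div_eq_mul_inv, ENNReal.ofReal_mul (by positivity), ENNReal.ofReal_pow (by norm_num),
    ENNReal.ofReal_ofNat] at h3
  exact (ENNReal.mul_right_inj (by simp) (by finiteness)).1 h3

lemma simplexVolume_eq (hd : 1 ≤ d) (u : Fin (d + 1) → Sphere d) :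
    simplexVolume u = (d ! : ℝ)⁻¹ * |(rowMatrix (edgeVectors u)).det| := by
  let M := (rowMatrix (edgeVectors u)).transpose
  have hcpt : IsCompact (convexHull ℝ (Set.range fun i => (u i : Space d))) :=
    (Set.finite_range _).isCompact_convexHull ℝ
  have h1 : WithLp.toLp 2 ⁻¹' convexHull ℝ (Set.range fun i => (u i : Space d)) =
      (fun y => WithLp.ofLp (u 0 : Space d) + y) '' (Matrix.toLin' M ''
        {y : Fin d → ℝ | (∀ i, 0 ≤ y i) ∧ ∑ i, y i ≤ 1}) := by
    have hL : ∀ y : Fin d → ℝ, WithLp.toLp 2 (WithLp.ofLp (u 0 : Space d) + Matrix.toLin' M y) =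
        (u 0 : Space d) + ∑ i, y i • edgeVectors u i := by
      intro y
      rw [sum_smul_eq_vecMul, Matrix.toLin'_apply, Matrix.mulVec_transpose]
      rfl
    ext z
    rw [Set.mem_preimage, mem_convexHull_range_iff, Set.image_image]
    constructor
    · rintro ⟨w, hw, hw1, hz⟩
      refine ⟨fun i => w i.succ, ⟨fun i => hw _, ?_⟩, ?_⟩
      · rw [Fin.sum_univ_succ] at hw1
        have := hw 0
        linarith
      · apply (WithLp.toLp_injective 2)
        rw [hL, ← hz, Fin.sum_univ_succ]
        rw [Fin.sum_univ_succ] at hw1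
        have : w 0 = 1 - ∑ i : Fin d, w i.succ := by linarith
        simp only [edgeVectors, smul_sub, Finset.sum_sub_distrib]
        rw [← Finset.sum_smul, this, sub_smul, one_smul]
        abel
    · rintro ⟨y, ⟨hy, hy1⟩, hz⟩
      refine ⟨Fin.cons (1 - ∑ i, y i) y, fun i => ?_, ?_, ?_⟩
      · refine Fin.cases ?_ (fun i => ?_) i
        · simpa using hy1
        · simpa using hy i
      · simp [Fin.sum_univ_succ]
      · rw [← hz, hL, Fin.sum_univ_succ]
        simp only [Fin.cons_zero, Fin.cons_succ, edgeVectors, smul_sub, Finset.sum_sub_distrib]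
        rw [← Finset.sum_smul, sub_smul, one_smul]
        abel
  rw [simplexVolume, ← (PiLp.volume_preserving_toLp (Fin d)).measure_preimage
    hcpt.isClosed.measurableSet.nullMeasurableSet, h1, Set.image_add_left, measure_preimage_add,
    Measure.addHaar_image_linearMap, volume_cornerSimplex hd, LinearMap.det_toLin',
    Matrix.det_transpose, ENNReal.toReal_mul, ENNReal.toReal_ofReal (abs_nonneg _),
    ENNReal.toReal_ofReal (by positivity), mul_comm]

end SimplexVolume

/-! ### `C_d` as an integral over surface measures -/

section SimplexConst

variable {d : ℕ}

lemma continuous_edgeVectors :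
    Continuous (edgeVectors : (Fin (d + 1) → Sphere d) → Fin d → Space d) := by
  unfold edgeVectors
  fun_prop

lemma isPointyTuple_edgeVectors_iff (u : Fin (d + 1) → Sphere d) :
    IsPointyTuple (edgeVectors u) (-(u 0 : Space d)) ↔ edgeVectors u ∈ pointySet d 0 := by
  have h : LinearIndependent ℝ (edgeVectors u) → -(u 0 : Space d) = circumcenter (edgeVectors u) := by
    intro hu
    refine circumcenter_unique hu (fun i => ?_)
      (norm_sub_circumcenter (linearIndependent_iff_det_ne_zero.1 hu))
    rw [edgeVectors, sub_neg_eq_add, sub_add_cancel, norm_neg, norm_eq_of_mem_sphere,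
      norm_eq_of_mem_sphere]
  constructor
  · intro hu
    exact ⟨h hu.1 ▸ hu, norm_nonneg _⟩
  · rintro ⟨hu, -⟩
    rwa [h hu.1]

/-- For degenerate simplices the two conditions may differ, but the volume vanishes. -/
lemma indicator_simplexVolume (hd : 1 ≤ d) (u : Fin (d + 1) → Sphere d) :
    {u : Fin (d + 1) → Sphere d | pointyCondition u}.indicator simplexVolume u =
      (d ! : ℝ)⁻¹ * ({u | edgeVectors u ∈ pointySet d 0}.indicator
        (fun u => |(rowMatrix (edgeVectors u)).det|) u) := by
  by_cases hdet : (rowMatrix (edgeVectors u)).det = 0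
  · simp [Set.indicator, simplexVolume_eq hd, hdet]
  · have h : pointyCondition u ↔ edgeVectors u ∈ pointySet d 0 := by
      rw [pointyCondition_iff hd (linearIndependent_iff_det_ne_zero.2 hdet),
        isPointyTuple_edgeVectors_iff]
    by_cases hu : u ∈ {u : Fin (d + 1) → Sphere d | edgeVectors u ∈ pointySet d 0}
    · rw [Set.indicator_of_mem (show u ∈ {u : Fin (d + 1) → Sphere d | pointyCondition u} from h.2 hu),
        Set.indicator_of_mem hu, simplexVolume_eq hd]
    · rw [Set.indicator_of_notMem (show u ∉ {u : Fin (d + 1) → Sphere d | pointyCondition u} from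
        fun hp => hu (h.1 hp)), Set.indicator_of_notMem hu, mul_zero]

lemma measurable_indicator_abs_det : Measurable
    ({u : Fin (d + 1) → Sphere d | edgeVectors u ∈ pointySet d 0}.indicator
      fun u => |(rowMatrix (edgeVectors u)).det|) :=
  ((measurable_det_rowMatrix.comp continuous_edgeVectors.measurable).norm).indicator
    (continuous_edgeVectors.measurable (measurableSet_pointySet 0))

lemma pi_uniformSphere (hd : 1 ≤ d) :
    Measure.pi (fun _ : Fin (d + 1) => uniformSphere d) =
      (surface d Set.univ)⁻¹ ^ (d + 1) • Measure.pi fun _ : Fin (d + 1) => surface d := by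
  have : Nonempty (Fin d) := ⟨⟨0, hd⟩⟩
  have h0 : surface d Set.univ ≠ 0 := by
    rw [Measure.toSphere_apply_univ]
    have : volume (Metric.ball (0 : Space d) 1) ≠ 0 := (Metric.measure_ball_pos _ _ one_pos).ne'
    simp only [finrank_euclideanSpace_fin]
    positivity
  have : IsFiniteMeasure ((surface d Set.univ)⁻¹ • surface d) :=
    Measure.smul_finite _ (ENNReal.inv_ne_top.2 h0)
  exact pi_const_smul (surface d) (surface d Set.univ)⁻¹

lemma simplexConst_nonneg : 0 ≤ simplexConst d :=
  integral_nonneg fun _ => Set.indicator_nonneg (fun _ _ => ENNReal.toReal_nonneg) _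

lemma ofReal_simplexConst (hd : 1 ≤ d) :
    ENNReal.ofReal (simplexConst d) = (surface d Set.univ)⁻¹ ^ (d + 1) * ((d ! : ℝ≥0∞)⁻¹ *
      ∫⁻ u, ({u : Fin (d + 1) → Sphere d | edgeVectors u ∈ pointySet d 0}.indicator
        (fun u => ENNReal.ofReal |(rowMatrix (edgeVectors u)).det|) u)
        ∂Measure.pi fun _ : Fin (d + 1) => surface d) := by
  have hnn : ∀ u : Fin (d + 1) → Sphere d, 0 ≤ (d ! : ℝ)⁻¹ *
      ({u | edgeVectors u ∈ pointySet d 0}.indicator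
        (fun u => |(rowMatrix (edgeVectors u)).det|) u) := fun u =>
    mul_nonneg (by positivity) (Set.indicator_nonneg (fun _ _ => abs_nonneg _) _)
  have : Nonempty (Fin d) := ⟨⟨0, hd⟩⟩
  have : IsFiniteMeasure (Measure.pi fun _ : Fin (d + 1) => uniformSphere d) := by
    have : IsFiniteMeasure (uniformSphere d) := by
      unfold uniformSphere
      infer_instance
    infer_instance
  have hint : Integrable (fun u : Fin (d + 1) → Sphere d => (d ! : ℝ)⁻¹ *
      ({u | edgeVectors u ∈ pointySet d 0}.indicator
        (fun u => |(rowMatrix (edgeVectors u)).det|) u))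
      (Measure.pi fun _ : Fin (d + 1) => uniformSphere d) := by
    refine Integrable.of_bound (measurable_const.mul
      measurable_indicator_abs_det).aestronglyMeasurable
      (volume (Metric.closedBall (0 : Space d) 1)).toReal (.of_forall fun u => ?_)
    rw [Real.norm_of_nonneg (hnn u), ← indicator_simplexVolume hd]
    refine (Set.indicator_le_self' (fun _ _ => ENNReal.toReal_nonneg) u).trans ?_
    refine ENNReal.toReal_mono measure_closedBall_lt_top.ne (measure_mono ?_)
    refine convexHull_min ?_ (convex_closedBall _ _)
    rintro _ ⟨i, rfl⟩
    simp
  rw [simplexConst]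
  simp only [indicator_simplexVolume hd]
  have hind : ∀ u : Fin (d + 1) → Sphere d, ENNReal.ofReal ((d ! : ℝ)⁻¹ *
      ({u | edgeVectors u ∈ pointySet d 0}.indicator
        (fun u => |(rowMatrix (edgeVectors u)).det|) u)) = (d ! : ℝ≥0∞)⁻¹ *
      ({u : Fin (d + 1) → Sphere d | edgeVectors u ∈ pointySet d 0}.indicator
        (fun u => ENNReal.ofReal |(rowMatrix (edgeVectors u)).det|) u) := by
    intro u
    rw [ENNReal.ofReal_mul (by positivity), ENNReal.ofReal_inv_of_pos (by positivity),
      ENNReal.ofReal_natCast]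
    congr 1
    simp only [Set.indicator]
    split_ifs <;> simp
  rw [ofReal_integral_eq_lintegral_ofReal hint (.of_forall hnn), pi_uniformSphere hd,
    lintegral_smul_measure, smul_eq_mul]
  simp only [hind]
  rw [lintegral_const_mul' _ _ (ENNReal.inv_ne_top.2 (by positivity))]

end SimplexConst
-- Balls as countable unions of fixed pieces
section BallCover

/-- Puts a moving ball into the form required by `mecke_void`. The pieces are balls of radius `1 /
(n + 1)` around a dense sequence, selected when the triangle inequality guarantees inclusion. -/
lemma exists_iUnion_eq_ball {X E : Type*} [MeasurableSpace X] [PseudoMetricSpace E]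
    [SecondCountableTopology E] [Nonempty E] [MeasurableSpace E] [BorelSpace E] {c : X → E}
    (hc : Measurable c) {r : X → ℝ} (hr : Measurable r) :
    ∃ (B : ℕ → Set E) (T : ℕ → Set X), (∀ j, MeasurableSet (B j)) ∧ (∀ j, MeasurableSet (T j)) ∧
      ∀ x, Metric.ball (c x) (r x) = ⋃ j, ⋃ (_ : x ∈ T j), B j := by
  let q := TopologicalSpace.denseSeq E
  let δ : ℕ → ℝ := fun n => 1 / ((n : ℝ) + 1)
  refine ⟨fun j => Metric.ball (q j.unpair.1) (δ j.unpair.2),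
    fun j => {x | dist (q j.unpair.1) (c x) + δ j.unpair.2 ≤ r x}, fun j => measurableSet_ball,
    fun j => measurableSet_le ((measurable_const.dist hc).add measurable_const) hr, fun x => ?_⟩
  ext y
  simp only [Metric.mem_ball, Set.mem_iUnion, Set.mem_ofPred_eq, exists_prop]
  constructor
  · intro hy
    obtain ⟨n, hn⟩ := exists_nat_one_div_lt (half_pos (sub_pos.2 hy))
    obtain ⟨m, hm⟩ := (TopologicalSpace.denseRange_denseSeq E).exists_dist_lt y
      (Nat.one_div_pos_of_nat (α := ℝ) (n := n))
    refine ⟨Nat.pair m n, ?_⟩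
    rw [Nat.unpair_pair]
    refine ⟨?_, hm⟩
    have h1 := dist_triangle (q m) y (c x)
    rw [dist_comm (q m) y] at h1
    simp only [δ, q] at h1 ⊢
    linarith
  · rintro ⟨j, hj, hy⟩
    have := dist_triangle y (q j.unpair.1) (c x)
    linarith

end BallCover

/-! ### The tuple count as an integral of void indicators -/

section Counting

variable {d : ℕ}

lemma mem_voidPointyTuples_iff {S : Set (Space d)} {t : ℝ} {x : Fin d → Space d} :
    x ∈ voidPointyTuples S t ↔ x ∈ injTuples S d ∧ x ∈ pointySet d t ∧
      S ∩ Metric.ball (circumcenter x) ‖circumcenter x‖ = ∅ := by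
  constructor
  · rintro ⟨hx, c, hc, ht, hv⟩
    obtain rfl := (isPointyTuple_iff.1 hc).2.1
    exact ⟨hx, ⟨hc, ht⟩, hv⟩
  · rintro ⟨hx, ⟨hc, ht⟩, hv⟩
    exact ⟨hx, _, hc, ht, hv⟩

lemma setLIntegral_void_tupleMeasure (S : Set (Space d)) (t : ℝ) :
    ∫⁻ x in pointySet d t, void S (Metric.ball (circumcenter x) ‖circumcenter x‖)
      ∂tupleMeasure S d = ((voidPointyTuples S t).encard : ℝ≥0∞) := by
  rw [← lintegral_indicator (measurableSet_pointySet t), tupleMeasure, lintegral_sum_measure]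
  simp only [lintegral_dirac]
  rw [tsum_subtype (injTuples S d) ((pointySet d t).indicator fun x =>
    void S (Metric.ball (circumcenter x) ‖circumcenter x‖)), ← ENNReal.tsum_set_one,
    tsum_subtype (voidPointyTuples S t) fun _ => (1 : ℝ≥0∞)]
  refine tsum_congr fun x => ?_
  have h := mem_voidPointyTuples_iff (S := S) (t := t) (x := x)
  simp only [Set.indicator, void]
  split_ifs <;> tauto

end Counting

/-! ### General position, and the expectation as an integral over tuples -/

section GeneralPosition

variable {d : ℕ} {Ω : Type*} [MeasurableSpace Ω] {Φ : Ω → Set (Space d)} {P : Measure Ω}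

lemma measurableSet_injective_tuples {E : Type*} [MeasurableSpace E] [MeasurableEq E] (k : ℕ) :
    MeasurableSet {x : Fin k → E | Function.Injective x} := by
  have h : {x : Fin k → E | Function.Injective x} = ⋂ i, ⋂ j, ⋂ (_ : i ≠ j), {x | x i = x j}ᶜ := by
    ext x
    simp only [Set.mem_ofPred_eq, Set.mem_iInter, Set.mem_compl_iff, Function.Injective]
    exact ⟨fun h i j hij hx => hij (h hx), fun h i j hx => by_contra fun hij => h i j hij hx⟩
  rw [h]
  exact .iInter fun i => .iInter fun j => .iInter fun _ =>
    (measurableSet_eq_fun (measurable_pi_apply i) (measurable_pi_apply j)).compl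

/-- The injective tuples of `d + 1` points such that the first one lies on the sphere through the
origin and the `d` other ones. -/
def cosphericalTuples (d : ℕ) : Set (Fin (d + 1) → Space d) :=
  {z | Function.Injective z ∧
    ‖z 0 - circumcenter (Fin.tail z)‖ = ‖circumcenter (Fin.tail z)‖}

lemma measurable_tail : Measurable (Fin.tail : (Fin (d + 1) → Space d) → Fin d → Space d) :=
  measurable_pi_iff.2 fun i => measurable_pi_apply i.succ

lemma measurableSet_cosphericalTuples : MeasurableSet (cosphericalTuples d) := by
  have h : Measurable fun z : Fin (d + 1) → Space d => circumcenter (Fin.tail z) :=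
    measurable_circumcenter.comp measurable_tail
  exact (measurableSet_injective_tuples _).inter
    (measurableSet_eq_fun ((measurable_pi_apply 0).sub h).norm h.norm)

lemma volume_cosphericalTuples (hd : 1 ≤ d) :
    Measure.pi (fun _ : Fin (d + 1) => (volume : Measure (Space d))) (cosphericalTuples d) = 0 := by
  have : Nonempty (Fin d) := ⟨⟨0, hd⟩⟩
  let N : Set (Space d × (Fin d → Space d)) := {p | ‖p.1 - circumcenter p.2‖ = ‖circumcenter p.2‖}
  have hN : MeasurableSet N := by
    have h : Measurable fun p : Space d × (Fin d → Space d) => circumcenter p.2 :=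
      measurable_circumcenter.comp measurable_snd
    exact measurableSet_eq_fun (measurable_fst.sub h).norm h.norm
  have h := measurePreserving_piFinSuccAbove (fun _ : Fin (d + 1) => (volume : Measure (Space d))) 0
  refine measure_mono_null (t := MeasurableEquiv.piFinSuccAbove (fun _ => Space d) 0 ⁻¹' N)
    (fun z hz => hz.2) ?_
  rw [h.measure_preimage hN.nullMeasurableSet, Measure.prod_apply_symm hN]
  refine (lintegral_congr fun x => ?_).trans lintegral_zero
  -- For a dependent tail the matrix inverse is `0` and so is `circumcenter`; the sphere is then a
  -- point, which is still null.
  refine measure_mono_null (t := Metric.sphere (circumcenter x) ‖circumcenter x‖) ?_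
    (Measure.addHaar_sphere _ _ _)
  intro y hy
  exact mem_sphere_iff_norm.2 hy

/-- The Mecke formula with empty void set: the expected number of such tuples is the measure of a
null set. -/
lemma ae_forall_notMem_cosphericalTuples (hd : 1 ≤ d) (hΦ : IsPoissonPointProcess Φ volume P) :
    ∀ᵐ ω ∂P, ∀ z ∈ injTuples (Φ ω) (d + 1), z ∉ cosphericalTuples d := by
  have h := hΦ.mecke_void (k := d + 1) (B := fun _ => ∅) (fun _ => .empty) (T := fun _ => ∅)
    (fun _ => .empty) (K := fun _ => ∅) (fun x => by simp) measurableSet_cosphericalTuples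
    (fun x hx => hx.1) (fun x _ => by simp) (fun x _ i => by simp)
  have h1 : ∀ S : Set (Space d), void S ∅ = 1 := fun S => by simp [void]
  simp only [h1, setLIntegral_one] at h
  have h2 : ∫⁻ ω, tupleMeasure (Φ ω) (d + 1) (cosphericalTuples d) ∂P = 0 := by
    rw [h.2, setLIntegral_measure_zero _ _ (volume_cosphericalTuples hd)]
  filter_upwards [(lintegral_eq_zero_iff' h.1).1 h2] with ω hω z hz hzA
  rw [Pi.zero_apply, tupleMeasure_apply measurableSet_cosphericalTuples] at hω
  have h3 : injTuples (Φ ω) (d + 1) ∩ cosphericalTuples d = ∅ := by simpa using hω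
  exact Set.notMem_empty z (h3 ▸ ⟨hz, hzA⟩)

lemma mem_range_of_notMem_cosphericalTuples {S : Set (Space d)}
    (hS : ∀ z ∈ injTuples S (d + 1), z ∉ cosphericalTuples d) {x : Fin d → Space d}
    (hx : x ∈ injTuples S d) {c : Space d} (hli : LinearIndependent ℝ x)
    (hc : ∀ i, ‖x i - c‖ = ‖c‖) {y : Space d} (hy : y ∈ S) (hyc : ‖y - c‖ = ‖c‖) :
    y ∈ Set.range x := by
  by_contra hyx
  have hinj : Function.Injective (Fin.cons y x : Fin (d + 1) → Space d) :=
    Fin.cons_injective_iff.2 ⟨hyx, hx.1⟩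
  refine hS (Fin.cons y x) ⟨hinj, fun i => ?_⟩ ⟨hinj, ?_⟩
  · refine Fin.cases ?_ (fun i => ?_) i
    · simpa using hy
    · simpa using hx.2 i
  · rw [Fin.tail_cons, Fin.cons_zero, ← circumcenter_unique hli hc
      (norm_sub_circumcenter (linearIndependent_iff_det_ne_zero.1 hli)), hyc]

theorem lintegral_numFarPointy (hd : 1 ≤ d) (hΦ : IsPoissonPointProcess Φ volume P) (t : ℝ) :
    AEMeasurable (fun ω => numFarPointy (Φ ω) t) P ∧
    ∫⁻ ω, numFarPointy (Φ ω) t ∂P = (d ! : ℝ≥0∞)⁻¹ * ∫⁻ x in pointySet d t,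
      ENNReal.ofReal (Real.exp (-(volume (Metric.ball (circumcenter x) ‖circumcenter x‖)).toReal))
        := by
  obtain ⟨B, T, hB, hT, hK⟩ := exists_iUnion_eq_ball (measurable_circumcenter (d := d))
    measurable_circumcenter.norm
  have h := hΦ.mecke_void hB hT hK (measurableSet_pointySet t)
    (fun x hx => hx.1.1.injective) (fun x _ => measure_ball_lt_top)
    (fun x hx i hi => (mem_ball_iff_norm.1 hi).ne (hx.1.2.1 i))
  simp only [setLIntegral_void_tupleMeasure] at h
  have hfin : ∀ᵐ ω ∂P, ∀ n : ℕ, (Φ ω ∩ Metric.closedBall 0 (n : ℝ)).Finite :=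
    ae_all_iff.2 fun n => hΦ.ae_finite_count measurableSet_closedBall measure_closedBall_lt_top
  have hae : (fun ω => numFarPointy (Φ ω) t) =ᵐ[P] fun ω =>
      (d ! : ℝ≥0∞)⁻¹ * ((voidPointyTuples (Φ ω) t).encard : ℝ≥0∞) := by
    filter_upwards [hfin, ae_forall_notMem_cosphericalTuples hd hΦ] with ω hω1 hω2
    rw [encard_voidPointyTuples (fun r => ?_) fun x hx c hli hc y hy hyc =>
      mem_range_of_notMem_cosphericalTuples hω2 hx hli hc hy hyc, ENat.toENNReal_mul,
      ENat.toENNReal_coe, ← mul_assoc, ENNReal.inv_mul_cancel (by positivity) (by simp),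
      one_mul, numFarPointy]
    obtain ⟨n, hn⟩ := exists_nat_ge r
    exact (hω1 n).subset (Set.inter_subset_inter_right _ (Metric.closedBall_subset_closedBall hn))
  refine ⟨(h.1.const_mul _).congr hae.symm, ?_⟩
  rw [lintegral_congr_ae hae, lintegral_const_mul'' _ h.1, h.2]
  rfl

end GeneralPosition
-- Separation into angular and radial integrals
section PolarPointy

variable {d : ℕ}

lemma IsPointyTuple.smul {x : Fin d → Space d} {c : Space d} (h : IsPointyTuple x c) {r : ℝ}
    (hr : 0 < r) : IsPointyTuple (fun i => r • x i) (r • c) := by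
  obtain ⟨hli, hc, w, hw, hwc⟩ := h
  refine ⟨?_, fun i => ?_, w, hw, ?_⟩
  · exact hli.units_smul fun _ => Units.mk0 r hr.ne'
  · rw [← smul_sub, norm_smul, norm_smul, hc]
  · rw [← hwc, Finset.smul_sum]
    exact Finset.sum_congr rfl fun i _ => smul_comm _ _ _

lemma smul_edgeVectors_mem_pointySet_iff {u : Fin (d + 1) → Sphere d} {r t : ℝ} (hr : 0 < r) :
    (fun i => r • edgeVectors u i) ∈ pointySet d t ↔ edgeVectors u ∈ pointySet d 0 ∧ t ≤ r := by
  have key : edgeVectors u ∈ pointySet d 0 →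
      IsPointyTuple (fun i => r • edgeVectors u i) (circumcenter fun i => r • edgeVectors u i) ∧
      ‖circumcenter fun i => r • edgeVectors u i‖ = r := by
    intro h
    have h1 := ((isPointyTuple_edgeVectors_iff u).2 h).smul hr
    have h2 := (isPointyTuple_iff.1 h1).2.1
    rw [← h2]
    refine ⟨h1, ?_⟩
    rw [norm_smul, norm_neg, norm_eq_of_mem_sphere, mul_one, Real.norm_of_nonneg hr.le]
  constructor
  · rintro ⟨h, ht⟩
    have h1 := h.smul (inv_pos.2 hr)
    simp only [smul_smul, inv_mul_cancel₀ hr.ne', one_smul] at h1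
    have h2 : edgeVectors u ∈ pointySet d 0 :=
      ⟨(isPointyTuple_iff.1 h1).2.1 ▸ h1, norm_nonneg _⟩
    exact ⟨h2, (key h2).2 ▸ ht⟩
  · rintro ⟨h, ht⟩
    exact ⟨(key h).1, (key h).2.symm ▸ ht⟩

lemma norm_circumcenter_smul_edgeVectors {u : Fin (d + 1) → Sphere d} {r : ℝ} (hr : 0 < r)
    (h : edgeVectors u ∈ pointySet d 0) : ‖circumcenter fun i => r • edgeVectors u i‖ = r := by
  rw [← (isPointyTuple_iff.1 (((isPointyTuple_edgeVectors_iff u).2 h).smul hr)).2.1, norm_smul,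
    norm_neg, norm_eq_of_mem_sphere, mul_one, Real.norm_of_nonneg hr.le]

lemma lintegral_pi_succ {α : Type*} [MeasurableSpace α] (μ : Measure α) [SigmaFinite μ] {n : ℕ}
    {f : (Fin (n + 1) → α) → ℝ≥0∞} (hf : Measurable f) :
    ∫⁻ z, f z ∂Measure.pi (fun _ => μ) =
      ∫⁻ v, ∫⁻ u, f (Fin.cons v u) ∂Measure.pi (fun _ : Fin n => μ) ∂μ := by
  have h := (measurePreserving_piFinSuccAbove (fun _ : Fin (n + 1) => μ) 0).symm
  rw [← h.lintegral_comp hf, lintegral_prod]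
  swap
  · exact (hf.comp h.measurable).aemeasurable
  refine lintegral_congr fun v => lintegral_congr fun u => ?_
  congr 1
  exact Fin.insertNth_zero' v u

/-- The exponent `d * (d - 1)` comes from Blaschke–Petkantschin, and the further `d - 1` from polar
coordinates for the center. -/
lemma setLIntegral_pointySet (hd : 1 ≤ d) {G : ℝ → ℝ≥0∞} (hG : Measurable G) {t : ℝ} (ht : 0 < t) :
    ∫⁻ x in pointySet d t, G ‖circumcenter x‖ =
      (∫⁻ u, ({u : Fin (d + 1) → Sphere d | edgeVectors u ∈ pointySet d 0}.indicator
        (fun u => ENNReal.ofReal |(rowMatrix (edgeVectors u)).det|) u)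
        ∂Measure.pi fun _ : Fin (d + 1) => surface d) *
      ∫⁻ r in Set.Ici t, ENNReal.ofReal (r ^ (d * (d - 1)) * r ^ (d - 1)) * G r := by
  let F : (Fin d → Space d) → ℝ≥0∞ := (pointySet d t).indicator fun x => G ‖circumcenter x‖
  have hF : Measurable F :=
    (hG.comp measurable_circumcenter.norm).indicator (measurableSet_pointySet t)
  have hF0 : ∀ x, (rowMatrix x).det = 0 → F x = 0 := fun x hx =>
    Set.indicator_of_notMem (fun h => (isPointyTuple_iff.1 h.1).1 hx) _
  let A : (Fin (d + 1) → Sphere d) → ℝ≥0∞ :=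
    {u : Fin (d + 1) → Sphere d | edgeVectors u ∈ pointySet d 0}.indicator
      fun u => ENNReal.ofReal |(rowMatrix (edgeVectors u)).det|
  have hA : Measurable A :=
    (measurable_det_rowMatrix.comp continuous_edgeVectors.measurable).norm.ennreal_ofReal.indicator
      (continuous_edgeVectors.measurable (measurableSet_pointySet 0))
  let R : ℝ → ℝ≥0∞ := (Set.Ici t).indicator fun r => ENNReal.ofReal (r ^ (d * (d - 1))) * G r
  have hR : Measurable R := Measurable.indicator (by fun_prop) measurableSet_Ici
  -- The reflection `c ↦ -c` makes the center `-r • v`, so that `x i = r • (u i - v)` is an edge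
  -- vector of the simplex with vertices `v` and the `u i`.
  rw [← lintegral_indicator (measurableSet_pointySet t),
    lintegral_blaschke_petkantschin hd hF hF0, ← lintegral_neg_eq_self]
  have hm : Measurable fun c : Space d => ∫⁻ u : Fin d → Sphere d,
      F (fun i => -c + ‖-c‖ • (u i : Space d)) * ENNReal.ofReal (‖-c‖ ^ (d * (d - 1)) *
        |(rowMatrix fun i => (u i : Space d) + ‖-c‖⁻¹ • -c).det|)
        ∂Measure.pi fun _ => surface d := by
    refine Measurable.lintegral_prod_right' (f := fun p : Space d × (Fin d → Sphere d) =>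
      F (fun i => -p.1 + ‖-p.1‖ • (p.2 i : Space d)) * ENNReal.ofReal (‖-p.1‖ ^ (d * (d - 1)) *
        |(rowMatrix fun i => (p.2 i : Space d) + ‖-p.1‖⁻¹ • -p.1).det|)) ?_
    refine (hF.comp (by fun_prop)).mul (Measurable.ennreal_ofReal (Measurable.mul (by fun_prop) ?_))
    exact (measurable_det_rowMatrix.comp (by fun_prop)).norm
  rw [lintegral_polar hd hm]
  have hkey : ∀ (v : Sphere d) (r : ℝ), 0 < r → ∀ u : Fin d → Sphere d,
      F (fun i => -(r • (v : Space d)) + ‖-(r • (v : Space d))‖ • (u i : Space d)) *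
        ENNReal.ofReal (‖-(r • (v : Space d))‖ ^ (d * (d - 1)) *
        |(rowMatrix fun i => (u i : Space d) +
          ‖-(r • (v : Space d))‖⁻¹ • -(r • (v : Space d))).det|) = A (Fin.cons v u) * R r := by
    intro v r hr u
    have h1 : ‖-(r • (v : Space d))‖ = r := by
      rw [norm_neg, norm_smul, norm_eq_of_mem_sphere, mul_one, Real.norm_of_nonneg hr.le]
    have h2 : (fun i => -(r • (v : Space d)) + r • (u i : Space d)) =
        fun i => r • edgeVectors (Fin.cons v u : Fin (d + 1) → Sphere d) i := by
      ext1 i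
      simp only [edgeVectors, Fin.cons_succ, Fin.cons_zero, smul_sub]
      abel
    have h3 : (fun i => (u i : Space d) + r⁻¹ • -(r • (v : Space d))) =
        edgeVectors (Fin.cons v u : Fin (d + 1) → Sphere d) := by
      ext1 i
      rw [smul_neg, smul_smul, inv_mul_cancel₀ hr.ne', one_smul, ← sub_eq_add_neg]
      simp [edgeVectors]
    rw [h1, h2, h3]
    by_cases he : (Fin.cons v u : Fin (d + 1) → Sphere d) ∈
      {u : Fin (d + 1) → Sphere d | edgeVectors u ∈ pointySet d 0}
    · by_cases htr : t ≤ r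
      · simp only [F, A, R]
        rw [Set.indicator_of_mem ((smul_edgeVectors_mem_pointySet_iff hr).2 ⟨he, htr⟩),
          Set.indicator_of_mem he, Set.indicator_of_mem (Set.mem_Ici.2 htr),
          norm_circumcenter_smul_edgeVectors hr he, ENNReal.ofReal_mul (by positivity)]
        ring
      · simp only [F, A, R]
        rw [Set.indicator_of_notMem fun h => htr ((smul_edgeVectors_mem_pointySet_iff hr).1 h).2,
          Set.indicator_of_notMem (s := Set.Ici t) htr, zero_mul, mul_zero]
    · simp only [F, A, R]
      rw [Set.indicator_of_notMem fun h => he ((smul_edgeVectors_mem_pointySet_iff hr).1 h).1,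
          Set.indicator_of_notMem he, zero_mul, zero_mul]
  have hinner : ∀ v : Sphere d, ∫⁻ r in Set.Ioi 0, ENNReal.ofReal (r ^ (d - 1)) *
      ∫⁻ u : Fin d → Sphere d,
      F (fun i => -(r • (v : Space d)) + ‖-(r • (v : Space d))‖ • (u i : Space d)) *
        ENNReal.ofReal (‖-(r • (v : Space d))‖ ^ (d * (d - 1)) *
        |(rowMatrix fun i => (u i : Space d) +
          ‖-(r • (v : Space d))‖⁻¹ • -(r • (v : Space d))).det|) ∂Measure.pi (fun _ => surface d) =
      (∫⁻ u : Fin d → Sphere d, A (Fin.cons v u) ∂Measure.pi fun _ => surface d) *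
        ∫⁻ r in Set.Ioi 0, ENNReal.ofReal (r ^ (d - 1)) * R r := by
    intro v
    rw [← lintegral_const_mul _ (by fun_prop)]
    refine setLIntegral_congr_fun measurableSet_Ioi fun r hr => ?_
    simp only [hkey v r hr]
    rw [lintegral_mul_const]
    · ring
    · exact hA.comp (measurable_pi_iff.2 fun i => Fin.cases (by simp) (fun i => by
        simpa using measurable_pi_apply i) i)
  simp only [hinner]
  have hJ : ∫⁻ r in Set.Ioi 0, ENNReal.ofReal (r ^ (d - 1)) * R r =
      ∫⁻ r in Set.Ici t, ENNReal.ofReal (r ^ (d * (d - 1)) * r ^ (d - 1)) * G r := by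
    have h1 : ∀ r, ENNReal.ofReal (r ^ (d - 1)) * R r = (Set.Ici t).indicator (fun r =>
        ENNReal.ofReal (r ^ (d * (d - 1)) * r ^ (d - 1)) * G r) r := by
      intro r
      by_cases hr : r ∈ Set.Ici t
      · have hr0 : 0 ≤ r := ht.le.trans hr
        simp only [R]
        rw [Set.indicator_of_mem hr, Set.indicator_of_mem hr, ENNReal.ofReal_mul (by positivity)]
        ring
      · simp only [R]
        rw [Set.indicator_of_notMem hr, Set.indicator_of_notMem hr, mul_zero]
    simp only [h1]
    rw [setLIntegral_indicator measurableSet_Ici, Set.inter_eq_left.2 (Set.Ici_subset_Ioi.2 ht)]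
  rw [hJ, lintegral_pi_succ _ hA, lintegral_mul_const]
  exact Measurable.lintegral_prod_right' (f := fun p : Sphere d × (Fin d → Sphere d) =>
    A (Fin.cons p.1 p.2)) (hA.comp (measurable_pi_iff.2 fun i => Fin.cases
      (by simpa using measurable_fst) (fun i => by
        simpa using measurable_snd.eval) i))

end PolarPointy
-- The incomplete gamma integral
section RadialIntegral

/-- The tail `∫_s^∞ y ^ n e ^ (-κ y) dy` of a gamma integral. -/
noncomputable def gammaTail (κ : ℝ) (n : ℕ) (s : ℝ) : ℝ :=
  (∑ i ∈ Finset.range (n + 1), (n ! : ℝ) / i ! * (κ * s) ^ i) / κ ^ (n + 1) * Real.exp (-κ * s)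

/-- The recursion given by integration by parts; it drives the induction for the derivative. -/
lemma gammaTail_succ {κ : ℝ} (hκ : 0 < κ) (n : ℕ) (s : ℝ) :
    gammaTail κ (n + 1) s =
      (n + 1) / κ * gammaTail κ n s + s ^ (n + 1) / κ * Real.exp (-κ * s) := by
  have h : ∑ i ∈ Finset.range (n + 1), ((n + 1)! : ℝ) / i ! * (κ * s) ^ i =
      (n + 1) * ∑ i ∈ Finset.range (n + 1), (n ! : ℝ) / i ! * (κ * s) ^ i := by
    rw [Finset.mul_sum]
    refine Finset.sum_congr rfl fun i _ => ?_
    rw [Nat.factorial_succ]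
    push_cast
    ring
  rw [gammaTail, gammaTail, Finset.sum_range_succ, h, div_self (by positivity)]
  field_simp
  ring

lemma hasDerivAt_gammaTail {κ : ℝ} (hκ : 0 < κ) (n : ℕ) (s : ℝ) :
    HasDerivAt (gammaTail κ n) (-(s ^ n * Real.exp (-κ * s))) s := by
  have hexp : HasDerivAt (fun s => Real.exp (-κ * s)) (Real.exp (-κ * s) * (-κ * 1)) s :=
    ((hasDerivAt_id s).const_mul (-κ)).exp
  induction n with
  | zero =>
    have h : gammaTail κ 0 = fun s => κ⁻¹ * Real.exp (-κ * s) := by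
      ext s
      simp [gammaTail]
    rw [h]
    refine (hexp.const_mul κ⁻¹).congr_deriv ?_
    field_simp
  | succ n ih =>
    have h : gammaTail κ (n + 1) = fun s =>
        (n + 1) / κ * gammaTail κ n s + s ^ (n + 1) / κ * Real.exp (-κ * s) := by
      ext s
      exact gammaTail_succ hκ n s
    rw [h]
    refine ((ih.const_mul _).add (((hasDerivAt_pow (n + 1) s).div_const κ).mul hexp)).congr_deriv ?_
    rw [Nat.add_sub_cancel]
    push_cast
    field_simp
    ring

lemma tendsto_gammaTail {κ : ℝ} (hκ : 0 < κ) (n : ℕ) :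
    Tendsto (gammaTail κ n) atTop (nhds 0) := by
  have h1 : gammaTail κ n = fun s => (κ ^ (n + 1))⁻¹ * ∑ i ∈ Finset.range (n + 1),
      (n ! : ℝ) / i ! * ((κ * s) ^ i * Real.exp (-(κ * s))) := by
    ext s
    simp only [gammaTail, Finset.sum_mul, Finset.mul_sum, Finset.sum_div, neg_mul]
    refine Finset.sum_congr rfl fun i _ => by ring
  rw [h1, ← mul_zero (κ ^ (n + 1))⁻¹]
  refine Tendsto.const_mul _ ?_
  rw [← Finset.sum_const_zero (s := Finset.range (n + 1))]
  refine tendsto_finsetSum _ fun i _ => ?_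
  rw [← mul_zero ((n ! : ℝ) / i !)]
  exact ((Real.tendsto_pow_mul_exp_neg_atTop_nhds_zero i).comp
    (tendsto_id.const_mul_atTop hκ)).const_mul _

/-- The substitution `y = r ^ d` turns the integrand into `d⁻¹ * y ^ (d - 1) * exp (-κ * y)`. -/
lemma lintegral_radial_tail {κ : ℝ} (hκ : 0 < κ) {d : ℕ} (hd : 1 ≤ d) {t : ℝ} (ht : 0 < t) :
    ∫⁻ r in Set.Ici t, ENNReal.ofReal (r ^ (d * (d - 1)) * r ^ (d - 1)) *
        ENNReal.ofReal (Real.exp (-(κ * r ^ d))) =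
      ENNReal.ofReal ((d : ℝ)⁻¹ * gammaTail κ (d - 1) (t ^ d)) := by
  have hd0 : (d : ℝ) ≠ 0 := by positivity
  have hderiv : ∀ r ∈ Set.Ici t, HasDerivAt (fun r => -((d : ℝ)⁻¹ * gammaTail κ (d - 1) (r ^ d)))
      (r ^ (d * (d - 1)) * r ^ (d - 1) * Real.exp (-(κ * r ^ d))) r := by
    intro r _
    convert! (((hasDerivAt_gammaTail hκ (d - 1) (r ^ d)).comp r
      (hasDerivAt_pow d r)).const_mul (d : ℝ)⁻¹).neg using 1
    rw [pow_mul, neg_mul κ]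
    field_simp
  have hpos : ∀ r ∈ Set.Ioi t,
      0 ≤ r ^ (d * (d - 1)) * r ^ (d - 1) * Real.exp (-(κ * r ^ d)) := by
    intro r hr
    have : 0 < r := ht.trans hr
    positivity
  have hlim : Tendsto (fun r : ℝ => -((d : ℝ)⁻¹ * gammaTail κ (d - 1) (r ^ d))) atTop (nhds 0) := by
    have h := (((tendsto_gammaTail hκ (d - 1)).comp
      (tendsto_pow_atTop (by omega : d ≠ 0))).const_mul (d : ℝ)⁻¹).neg
    simpa using h
  have hi := integral_Ioi_of_hasDerivAt_of_nonneg' hderiv hpos hlim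
  have hint := integrableOn_Ioi_deriv_of_nonneg' hderiv hpos hlim
  rw [setLIntegral_congr Ioi_ae_eq_Ici.symm]
  rw [zero_sub, neg_neg] at hi
  rw [← hi, ofReal_integral_eq_lintegral_ofReal hint
    ((ae_restrict_iff' measurableSet_Ioi).2 (.of_forall hpos))]
  refine setLIntegral_congr_fun measurableSet_Ioi fun r hr => ?_
  have : 0 < r := ht.trans hr
  exact (ENNReal.ofReal_mul (by positivity)).symm

end RadialIntegral

/-! ### Constants, the exact expectation and the asymptotics -/

section Expectation

variable {d : ℕ}

lemma kappa_pos (d : ℕ) : 0 < kappa d := by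
  unfold kappa
  have : 0 < Real.Gamma ((d : ℝ) / 2 + 1) := Real.Gamma_pos_of_pos (by positivity)
  positivity

lemma volume_ball_eq (hd : 1 ≤ d) (c : Space d) (r : ℝ) :
    volume (Metric.ball c r) = ENNReal.ofReal r ^ d * ENNReal.ofReal (kappa d) := by
  have : Nonempty (Fin d) := ⟨⟨0, hd⟩⟩
  rw [EuclideanSpace.volume_ball, Fintype.card_fin, kappa, Real.sqrt_eq_rpow, ← Real.rpow_natCast,
    ← Real.rpow_mul Real.pi_nonneg, one_div_mul_eq_div]

lemma surface_univ (hd : 1 ≤ d) : surface d Set.univ = ENNReal.ofReal (d * kappa d) := by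
  rw [Measure.toSphere_apply_univ, finrank_euclideanSpace_fin, volume_ball_eq hd,
    ENNReal.ofReal_mul (by positivity)]
  simp

theorem lintegral_numFarPointy_eq_gammaTail {Ω : Type*} [MeasurableSpace Ω] {P : Measure Ω}
    {Φ : Ω → Set (Space d)} (hd : 1 ≤ d) (hΦ : IsPoissonPointProcess Φ volume P) {t : ℝ}
    (ht : 0 < t) :
    ∫⁻ ω, numFarPointy (Φ ω) t ∂P = ENNReal.ofReal ((d * kappa d) ^ (d + 1) * simplexConst d *
      ((d : ℝ)⁻¹ * gammaTail (kappa d) (d - 1) (t ^ d))) := by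
  have hκ := kappa_pos d
  have hd0 : (0 : ℝ) < d := by exact_mod_cast hd
  have hG : Measurable fun r : ℝ => ENNReal.ofReal (Real.exp (-(kappa d * r ^ d))) := by fun_prop
  have h1 : ∀ x : Fin d → Space d,
      (volume (Metric.ball (circumcenter x) ‖circumcenter x‖)).toReal =
        kappa d * ‖circumcenter x‖ ^ d := by
    intro x
    rw [volume_ball_eq hd, ENNReal.toReal_mul, ENNReal.toReal_pow,
      ENNReal.toReal_ofReal (norm_nonneg _), ENNReal.toReal_ofReal hκ.le, mul_comm]
  rw [(lintegral_numFarPointy hd hΦ t).2]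
  simp only [h1]
  rw [setLIntegral_pointySet hd hG ht, lintegral_radial_tail hκ hd ht, ← mul_assoc,
    ENNReal.ofReal_mul (mul_nonneg (by positivity) simplexConst_nonneg),
    ENNReal.ofReal_mul (p := (d * kappa d) ^ (d + 1)) (by positivity), ofReal_simplexConst hd, ENNReal.ofReal_pow (by positivity),
    ← surface_univ hd, ← mul_assoc, ← mul_pow, ENNReal.mul_inv_cancel, one_pow, one_mul]
  · rw [surface_univ hd]
    exact (ENNReal.ofReal_pos.2 (by positivity)).ne'
  · exact measure_ne_top _ _

lemma gammaTail_constant (hd : 1 ≤ d) (t : ℝ) :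
    (d * kappa d) ^ (d + 1) * simplexConst d * ((d : ℝ)⁻¹ * gammaTail (kappa d) (d - 1) (t ^ d)) =
      (d * kappa d) ^ d * simplexConst d * ∑ i ∈ Finset.range d,
        t ^ (d * i) * kappa d ^ ((i : ℤ) - d + 1) * (((d - 1)! : ℝ) / (i ! : ℝ)) *
          Real.exp (-kappa d * t ^ d) := by
  have hκ := (kappa_pos d).ne'
  have hd0 : (d : ℝ) ≠ 0 := by positivity
  have h : ∑ i ∈ Finset.range d, t ^ (d * i) * kappa d ^ ((i : ℤ) - d + 1) *
      (((d - 1)! : ℝ) / (i ! : ℝ)) * Real.exp (-kappa d * t ^ d) =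
      kappa d * gammaTail (kappa d) (d - 1) (t ^ d) := by
    rw [gammaTail, Nat.sub_add_cancel hd, Finset.sum_div, Finset.sum_mul, Finset.mul_sum]
    refine Finset.sum_congr rfl fun i _ => ?_
    rw [zpow_add₀ hκ, zpow_sub₀ hκ, zpow_natCast, zpow_natCast, zpow_one, mul_pow, ← pow_mul]
    ring
  rw [h]
  field_simp
  ring

/-- The term `i = d - 1` has coefficient exactly `1`; all others have lower degree in `t`. -/
lemma isEquivalent_sum_pow (hd : 1 ≤ d) :
    (fun t : ℝ => ∑ i ∈ Finset.range d, t ^ (d * i) * kappa d ^ ((i : ℤ) - d + 1) *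
      (((d - 1)! : ℝ) / (i ! : ℝ)) * Real.exp (-kappa d * t ^ d)) ~[atTop]
      fun t => t ^ (d * (d - 1)) * Real.exp (-kappa d * t ^ d) := by
  obtain ⟨n, rfl⟩ : ∃ n, d = n + 1 := ⟨d - 1, by omega⟩
  simp only [← Finset.sum_mul]
  refine IsEquivalent.mul ?_ IsEquivalent.refl
  rw [IsEquivalent]
  have h : ((fun t : ℝ => ∑ i ∈ Finset.range (n + 1), t ^ ((n + 1) * i) *
      kappa (n + 1) ^ ((i : ℤ) - (n + 1 : ℕ) + 1) * (((n + 1 - 1)! : ℝ) / (i ! : ℝ))) -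
      fun t => t ^ ((n + 1) * (n + 1 - 1))) = fun t => ∑ i ∈ Finset.range n,
        kappa (n + 1) ^ ((i : ℤ) - (n + 1 : ℕ) + 1) * (((n + 1 - 1)! : ℝ) / (i ! : ℝ)) *
          t ^ ((n + 1) * i) := by
    ext t
    have h0 : (n : ℤ) - (n + 1 : ℕ) + 1 = 0 := by push_cast; ring
    rw [Pi.sub_apply, Finset.sum_range_succ, h0, zpow_zero, Nat.add_sub_cancel,
      div_self (by positivity), mul_one, mul_one, add_sub_cancel_right]
    exact Finset.sum_congr rfl fun i _ => by ring
  rw [h]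
  refine IsLittleO.fun_sum fun i hi => IsLittleO.const_mul_left (isLittleO_pow_pow_atTop_of_lt ?_) _
  rw [Nat.add_sub_cancel]
  exact Nat.mul_lt_mul_of_pos_left (Finset.mem_range.1 hi) n.succ_pos

end Expectation
end PoissonVoronoi

theorem mainTheorem5 {Ω : Type*} [MeasurableSpace Ω] (P : Measure Ω) [IsProbabilityMeasure P]
    (d : ℕ) (hd : 1 ≤ d) (Φ : Ω → Set (PoissonVoronoi.Space d))
    (hΦ : PoissonVoronoi.IsPoissonPointProcess Φ volume P) :
    (∀ t : ℝ, 0 < t →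
      AEMeasurable (fun ω => PoissonVoronoi.numFarPointy (Φ ω) t) P ∧
      ∫⁻ ω, PoissonVoronoi.numFarPointy (Φ ω) t ∂P =
        ENNReal.ofReal
          ((d * PoissonVoronoi.kappa d) ^ d * PoissonVoronoi.simplexConst d *
            ∑ i ∈ Finset.range d,
              t ^ (d * i) * PoissonVoronoi.kappa d ^ ((i : ℤ) - d + 1) *
                (((d - 1)! : ℝ) / (i ! : ℝ)) * Real.exp (-PoissonVoronoi.kappa d * t ^ d))) ∧
    (fun t : ℝ => (∫⁻ ω, PoissonVoronoi.numFarPointy (Φ ω) t ∂P).toReal) ~[atTop]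
      (fun t : ℝ => (d * PoissonVoronoi.kappa d) ^ d * PoissonVoronoi.simplexConst d *
        t ^ (d * (d - 1)) * Real.exp (-PoissonVoronoi.kappa d * t ^ d)) := by
  have hformula : ∀ t : ℝ, 0 < t → ∫⁻ ω, PoissonVoronoi.numFarPointy (Φ ω) t ∂P =
        ENNReal.ofReal
          ((d * PoissonVoronoi.kappa d) ^ d * PoissonVoronoi.simplexConst d *
            ∑ i ∈ Finset.range d,
              t ^ (d * i) * PoissonVoronoi.kappa d ^ ((i : ℤ) - d + 1) *
                (((d - 1)! : ℝ) / (i ! : ℝ)) * Real.exp (-PoissonVoronoi.kappa d * t ^ d)) :=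
    fun t ht => by
      rw [PoissonVoronoi.lintegral_numFarPointy_eq_gammaTail hd hΦ ht,
        PoissonVoronoi.gammaTail_constant hd]
  refine ⟨fun t ht => ⟨(PoissonVoronoi.lintegral_numFarPointy hd hΦ t).1, hformula t ht⟩, ?_⟩
  -- The constant enters as a common factor, so the equivalence does not depend on `C_d` being
  -- nonzero.
  have h := (IsEquivalent.refl (u := fun _ : ℝ => (d * PoissonVoronoi.kappa d) ^ d *
    PoissonVoronoi.simplexConst d) (l := atTop)).mul (PoissonVoronoi.isEquivalent_sum_pow hd)
  refine (h.congr_left ?_).congr_right (.of_forall fun t => ?_)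
  · filter_upwards [eventually_gt_atTop 0] with t ht
    have hκ := PoissonVoronoi.kappa_pos d
    have hC := PoissonVoronoi.simplexConst_nonneg (d := d)
    rw [hformula t ht, ENNReal.toReal_ofReal (by positivity)]
    rfl
  · simp only [Pi.mul_apply]
    ring
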